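/- Setting. Node $i\in\{1,\dots,N\}$ stores $\tilde A_i=A+\tilde R_i$ and $\tilde B_i=B+\tilde S_i$ and outputs $\tilde C_i=\tilde A_i\tilde B_i$. Here $A,B$ are independent real random variables with $\mathbb E[A^2],\mathbb E[B^2]\le\eta$. The noise variables have mean zero, the vectors $(\tilde R_i)_i$ and $(\tilde S_i)_i$ are independent of each other, and the noise is independent of $(A,B)$. A secure multiplication scheme $\mathcal C$ consists of the joint law of $(\tilde R_i,\tilde S_i)_{i}$ and a Borel decoding function $d:(\mathbb R\cup\{\varepsilon_0\})^N\to\mathbb R$, where $\varepsilon_0$ is the erasure symbol; neither depends on the laws of $A$ and $B$. For sets $\mathcal E,\mathcal A$ of erased and of adversarial nodes let $\mathcal Y_{\mathcal E,\mathcal A}$ be the set of all $Y\in(\mathbb R\cup\{\varepsilon_0\})^N$ with $Y_i=\tilde C_i$ for $i\notin\mathcal E\cup\mathcal A$ and $Y_i=\varepsilon_0$ for $i\in\mathcal E$, and put $$\mathrm{MSE}(\mathcal C)=\sup_{|\mathcal E|\le E,\ |\mathcal A|\le \mathsf A}\ \mathbb E\Big[\sup_{Y\in\mathcal Y_{\mathcal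 E,\mathcal A}}(d(Y)-AB)^2\Big].$$ (Here $\mathsf A$, the maximal number of adversarial nodes, is not to be confused with the input $A$.) The scheme is $T$-node $\epsilon$-DP if for every set $\mathcal T$ of $T$ nodes, all reals $a_0,a_1$ with $|a_0-a_1|\le1$ and every Borel set $\mathcal B\subseteq\mathbb R^{\mathcal T}$, $\mathbb P\big((a_0+\tilde R_t)_{t\in\mathcal T}\in\mathcal B\big)\le e^{\epsilon}\,\mathbb P\big((a_1+\tilde R_t)_{t\in\mathcal T}\in\mathcal B\big)$, and the same holds with $\tilde S$ in place of $\tilde R$. Let $(\sigma^*(\epsilon))^2$ be the infimum of the variances of all square-integrable real random variables $X$ such that $\mathbb P(x'+X\in\mathcal B)\le e^{\epsilon}\,\mathbb P(x''+X\in\mathcal B)$ for all Borel $\mathcal B\subseteq\mathbb R$ and all $|x'-x''|\le1$, and let $\mathrm{SNR}^*=\eta/(\sigma^*(\epsilon))^2$. Theorem. Let $\epsilon>0$, $\eta\ge0$, let $T,E,\mathsf A$ be non-negative integers, and let $N\ge T+E+2\mathsf A+1$. For every $\gamma>0$ there is an $N$-node secure multiplication scheme $\mathcal C$ that is $T$-node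 $\epsilon$-DP, whose decoder is an error-decoding rule (from every received word with at least $T+1$ non-erased symbols it selects $T+1$ non-erased nodes and outputs a linear combination of their symbols, with coefficients that depend only on the set of selected nodes), and that satisfies $$\mathrm{MSE}(\mathcal C)\le\frac{\eta^2}{(1+\mathrm{SNR}^*)^2}+\gamma$$ for all independent inputs $A,B$ with $\mathbb E[A^2],\mathbb E[B^2]\le\eta$, in the presence of at most $E$ erasures and at most $\mathsf A$ adversarial nodes. -/

import Mathlib

open MeasureTheory ProbabilityTheory
open scoped ENNReal

namespace SecureMult

/-! ### Noise mechanisms on the real line -/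

/-- The additive noise with law `μ` is `ε`-differentially private on the real line: the laws of
`x' + X` and `x'' + X`, for `|x' - x''| ≤ 1`, are within a factor `exp ε` of each other on every
Borel set. (The ratio is cleared of its denominator.) -/
def NoiseDP (ε : ℝ) (μ : Measure ℝ) : Prop :=
  ∀ x' x'' : ℝ, |x' - x''| ≤ 1 → ∀ B : Set ℝ, MeasurableSet B →
    μ {z | x' + z ∈ B} ≤ ENNReal.ofReal (Real.exp ε) * μ {z | x'' + z ∈ B}

/-- `(σ*(ε))²`: the infimum of the variances of all square-integrable real noise variables
that are `ε`-differentially private. -/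
noncomputable def optNoiseVar (ε : ℝ) : ℝ :=
  sInf {v : ℝ | ∃ μ : Measure ℝ, IsProbabilityMeasure μ ∧ NoiseDP ε μ ∧
    MemLp (fun x : ℝ => x) 2 μ ∧ v = Var[fun x : ℝ => x; μ]}

/-- `SNR* = η / (σ*(ε))²`. -/
noncomputable def optSNR (η ε : ℝ) : ℝ := η / optNoiseVar ε

/-! ### Coding schemes -/

/-- The nodes of a received word whose symbol is not the erasure symbol `none`. -/
def received {N : ℕ} (y : Fin N → Option ℝ) : Finset (Fin N) :=
  Finset.univ.filter fun i => (y i).isSome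

/-- An `N`-node secure multiplication coding scheme: a joint law of the noise vectors
`(R̃ᵢ)ᵢ, (S̃ᵢ)ᵢ`, which have mean zero and are independent of each other, and a (Borel) decoding
function on `(ℝ ∪ {erasure})^N`. The space of words is the disjoint union, over the erasure
patterns `F`, of copies of Euclidean spaces, and measurability is required on each of these. -/
structure Scheme (N : ℕ) where
  /-- the joint law of the two noise vectors -/
  noise : Measure ((Fin N → ℝ) × (Fin N → ℝ))
  /-- the decoding function -/
  dec : (Fin N → Option ℝ) → ℝ
  isProb : IsProbabilityMeasure noise
  integrable_fst : ∀ i, Integrable (fun ω => ω.1 i) noise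
  integrable_snd : ∀ i, Integrable (fun ω => ω.2 i) noise
  mean_fst : ∀ i, ∫ ω, ω.1 i ∂noise = 0
  mean_snd : ∀ i, ∫ ω, ω.2 i ∂noise = 0
  indep : IndepFun (fun ω : (Fin N → ℝ) × (Fin N → ℝ) => ω.1) (fun ω => ω.2) noise
  measurable_dec : ∀ F : Finset (Fin N),
    Measurable fun y : Fin N → ℝ => dec fun i => if i ∈ F then none else some (y i)

/-- `T`-node `ε`-differential privacy: for any `T` nodes, the data that they store about the first
input, and the data that they store about the second one, are `ε`-differentially private. -/
def Scheme.NodeDP {N : ℕ} (C : Scheme N) (T : ℕ) (ε : ℝ) : Prop :=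
  ∀ a₀ b₀ a₁ b₁ : ℝ, |a₀ - a₁| ≤ 1 → |b₀ - b₁| ≤ 1 →
    ∀ 𝒯 : Finset (Fin N), 𝒯.card = T → ∀ B : Set (𝒯 → ℝ), MeasurableSet B →
      C.noise {ω | (fun t : 𝒯 => a₀ + ω.1 t) ∈ B} ≤
          ENNReal.ofReal (Real.exp ε) * C.noise {ω | (fun t : 𝒯 => a₁ + ω.1 t) ∈ B} ∧
        C.noise {ω | (fun t : 𝒯 => b₀ + ω.2 t) ∈ B} ≤
          ENNReal.ofReal (Real.exp ε) * C.noise {ω | (fun t : 𝒯 => b₁ + ω.2 t) ∈ B}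

/-- The words that the decoder may receive when the nodes output `c`, the nodes in `Er` are erased
and those in `Ad` are adversarial: erased nodes show the erasure symbol, the nodes outside of both
sets show their output, and the other adversarial nodes show anything. -/
def words {N : ℕ} (c : Fin N → ℝ) (Er Ad : Finset (Fin N)) : Set (Fin N → Option ℝ) :=
  {y | (∀ i, i ∉ Er → i ∉ Ad → y i = some (c i)) ∧ ∀ i ∈ Er, y i = none}

/-- The expectation of `f ≥ 0` as an upper integral, the infimum of the integrals of the measurable
majorants. It is the usual integral when `f` is measurable; a supremum over all adversarial words
need not be Borel. -/
noncomputable def upperExpectation {Ω : Type*} [MeasurableSpace Ω] (P : Measure Ω)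
    (f : Ω → ℝ≥0∞) : ℝ≥0∞ :=
  ⨅ (g : Ω → ℝ≥0∞) (_ : Measurable g) (_ : ∀ ω, f ω ≤ g ω), ∫⁻ ω, g ω ∂P

/-- The mean square error for fixed erased nodes `Er` and adversarial nodes `Ad`, when the inputs
have laws `α` and `β` and the inputs and the noise are independent (product law): the expectation
of the largest squared error over the words that the decoder may receive. A sample point is
`((a, b), (r, s))`, and node `i` outputs `(a + r i) * (b + s i)`. -/
noncomputable def Scheme.mseAt {N : ℕ} (C : Scheme N) (α β : Measure ℝ)
    (Er Ad : Finset (Fin N)) : ℝ≥0∞ :=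
  upperExpectation ((α.prod β).prod C.noise) fun ω =>
    ⨆ y ∈ words (fun i => (ω.1.1 + ω.2.1 i) * (ω.1.2 + ω.2.2 i)) Er Ad,
      ENNReal.ofReal ((C.dec y - ω.1.1 * ω.1.2) ^ 2)

/-- The mean square error in presence of at most `E` erasures and at most `A` adversaries. -/
noncomputable def Scheme.mse {N : ℕ} (C : Scheme N) (E A : ℕ) (α β : Measure ℝ) : ℝ≥0∞ :=
  ⨆ (Er : Finset (Fin N)) (Ad : Finset (Fin N)) (_ : Er.card ≤ E) (_ : Ad.card ≤ A),
    C.mseAt α β Er Ad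

/-- The decoder is an error-decoding rule: from the received word it selects `k` of the non-erased
nodes, discarding all other symbols, and outputs a linear combination of the selected symbols whose
coefficients depend on the selected set only. (Words with fewer than `k` non-erased symbols are
left out.) -/
def Scheme.SelectsThenLinear {N : ℕ} (C : Scheme N) (k : ℕ) : Prop :=
  ∃ (sel : (Fin N → Option ℝ) → Finset (Fin N)) (w : Finset (Fin N) → Fin N → ℝ),
    ∀ y : Fin N → Option ℝ, k ≤ (received y).card →
      sel y ⊆ received y ∧ (sel y).card = k ∧
        C.dec y = ∑ i ∈ sel y, w (sel y) i * (y i).getD 0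

/-- The law of an input `X` with `E[X²] ≤ η`. -/
def InputLaw (η : ℝ) (α : Measure ℝ) : Prop :=
  IsProbabilityMeasure α ∧ ∫⁻ x, ENNReal.ofReal (x ^ 2) ∂α ≤ ENNReal.ofReal η

end SecureMult

/-! Without collusion (T = 0) the nodes need no noise. For T = t + 1, take independent centred
variables X₀, …, X_t and let node i carry the noise X₀ + τ² pᵢ(X), where pᵢ(X) = τ(i^(t+1) + κ)X₀ +
∑_{j≥1} i^j X_j and τ is small; the second input is treated likewise with Y. Expanding (a + R̃ᵢ)(b +
S̃ᵢ) in τ² gives (a + X₀)(b + Y₀), then first-order terms linear in pᵢ(X) and pᵢ(Y), then τ⁴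
pᵢ(X)pᵢ(Y).

Accuracy. On any t + 2 nodes, Lagrange weights can annihilate i, …, i^t and prescribe the pairings
with 1 and with i^(t+1). The annihilated powers carry X₁, …, X_t, so every combination c₁(a + X₀)(b
+ Y₀) + c₂((a + X₀)Y₀ + (b + Y₀)X₀) is reachable. The weights are O(τ⁻³), so the second-order term
contributes only O(τ) (`exists_estimate_bound`); this is why T + 1 nodes suffice although the
product of two codewords has higher degree. For suitable c₁, c₂ the error is, up to sign, the
product of the errors of the linear estimators of A from A + X₀ and of B from B + Y₀
(`lintegral_linear_estimate_le`). That yields (ηv/(η + v))² = η²/(1 + η/v)², where v bounds the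
variance of X₀.

Privacy. For any t + 1 nodes, a change of the input equals a shift of (X₀, …, X_t) whose first
coordinate has size at most that of the change and whose other coordinates are O(τ)
(`exists_shift`). So X₀ pays almost the whole privacy cost. The O(τ) remainder must fit into ε,
hence X₀ needs a parameter strictly below ε at nearly optimal variance
(`exists_noise_near_optimal`).

Errors. All estimates from t + 2 correct symbols agree up to O(τ). A decoder that looks for T + 1 +
𝖠 received nodes with the most consistent estimates is therefore off by O(τ) whatever the
adversaries show (`abs_decode_sub_le`). -/

namespace SecureMult

/-! ### Shifts of measures and densities of private noise -/

/-- Shifting the measure `μ` by `u` increases it by a factor `exp c` at most. -/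
def ShiftBound {E : Type*} [Add E] [MeasurableSpace E] (μ : Measure E) (u : E) (c : ℝ) : Prop :=
  ∀ B : Set E, MeasurableSet B → μ {z | u + z ∈ B} ≤ ENNReal.ofReal (Real.exp c) * μ B

theorem ShiftBound.mono {E : Type*} [Add E] [MeasurableSpace E] {μ : Measure E} {u : E} {c d : ℝ}
    (h : ShiftBound μ u c) (hcd : c ≤ d) : ShiftBound μ u d := fun B hB =>
  (h B hB).trans (by gcongr)

theorem noiseDP_iff_shiftBound {ε : ℝ} {μ : Measure ℝ} :
    NoiseDP ε μ ↔ ∀ u : ℝ, |u| ≤ 1 → ShiftBound μ u ε := by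
  constructor
  · intro h u hu B hB
    simpa using h u 0 (by simpa using hu) B hB
  · intro h x' x'' hx B hB
    have := h (x' - x'') hx {z | x'' + z ∈ B} (measurable_const_add x'' hB)
    convert this using 3
    ext z
    simp only [Set.mem_ofPred_eq]
    ring_nf

theorem ShiftBound.map_add_const {μ : Measure ℝ} {u c : ℝ} (h : ShiftBound μ u c) (a : ℝ) :
    ShiftBound (μ.map (· + a)) u c := by
  intro B hB
  have hm : Measurable fun x : ℝ => x + a := measurable_add_const a
  have hB' : MeasurableSet {z | u + z ∈ B} := measurable_const_add u hB
  rw [Measure.map_apply hm hB, Measure.map_apply hm hB']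
  convert h ((· + a) ⁻¹' B) (hm hB) using 3
  ext z
  simp [add_assoc]

theorem ShiftBound.smul {μ : Measure ℝ} {u c : ℝ} (h : ShiftBound μ u c) (k : ℝ≥0∞) :
    ShiftBound (k • μ) u c := by
  intro B hB
  simp only [Measure.smul_apply, smul_eq_mul]
  rw [mul_left_comm]
  gcongr
  exact h B hB

theorem shiftBound_withDensity {q : ℝ → ℝ≥0∞} {u c : ℝ}
    (h : ∀ᵐ x, q (x - u) ≤ ENNReal.ofReal (Real.exp c) * q x) :
    ShiftBound (volume.withDensity q) u c := by
  intro B hB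
  have hB' : MeasurableSet {z | u + z ∈ B} := measurable_const_add u hB
  rw [withDensity_apply _ hB, withDensity_apply _ hB', ← lintegral_const_mul' _ _ (by simp),
    ← lintegral_indicator hB, ← lintegral_indicator hB',
    ← lintegral_sub_right_eq_self (μ := volume) _ u]
  refine lintegral_mono_ae (h.mono fun x hx => ?_)
  by_cases hxB : x ∈ B <;> simp [Set.indicator, hxB, hx]

/-- By Fubini, almost every translate of a Lebesgue-null set is `μ`-null. One such translation lies
in [0, 1], and privacy carries nullity back to the set itself. -/
theorem absolutelyContinuous_of_noiseDP {ε : ℝ} {μ : Measure ℝ} [IsFiniteMeasure μ]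
    (h : NoiseDP ε μ) : μ ≪ volume := by
  refine Measure.AbsolutelyContinuous.mk fun B hB hB0 => ?_
  have hmeas : MeasurableSet {p : ℝ × ℝ | p.1 + p.2 ∈ B} :=
    (measurable_fst.add measurable_snd) hB
  have h0 : (volume.prod μ) {p : ℝ × ℝ | p.1 + p.2 ∈ B} = 0 := by
    rw [Measure.prod_apply_symm hmeas]
    refine lintegral_eq_zero_of_ae_eq_zero (ae_of_all _ fun y => ?_)
    change volume {x : ℝ | x + y ∈ B} = 0
    rw [← hB0]
    exact measure_preimage_add_right volume y B
  rw [Measure.prod_apply hmeas, lintegral_eq_zero_iff (measurable_measure_prodMk_left hmeas)] at h0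
  obtain ⟨t, ht, ht0⟩ : ∃ t ∈ Set.Icc (0 : ℝ) 1, μ {z | t + z ∈ B} = 0 := by
    by_contra! hne
    have : volume (Set.Icc (0 : ℝ) 1) = 0 :=
      measure_mono_null (fun t ht => hne t ht) (ae_iff.1 h0)
    simp at this
  have := h 0 t (by rw [zero_sub, abs_neg, abs_of_nonneg ht.1]; exact ht.2) B hB
  simpa [ht0] using this

/-- Geometric interpolation acts on densities, so the bound on sets is needed in pointwise form. -/
theorem rnDeriv_sub_le_of_shiftBound {μ : Measure ℝ} [IsFiniteMeasure μ] (hμ : μ ≪ volume)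
    {u c : ℝ} (h : ShiftBound μ u c) :
    ∀ᵐ x, μ.rnDeriv volume (x - u) ≤ ENNReal.ofReal (Real.exp c) * μ.rnDeriv volume x := by
  have hm := Measure.measurable_rnDeriv μ volume
  refine ae_le_of_forall_setLIntegral_le_of_sigmaFinite
    (hm.comp (measurable_sub_const u)) fun B hB _ => ?_
  have hB' : MeasurableSet {z | u + z ∈ B} := measurable_const_add u hB
  rw [lintegral_const_mul _ hm, Measure.setLIntegral_rnDeriv hμ]
  refine le_trans (le_of_eq ?_) (h B hB)
  rw [← Measure.setLIntegral_rnDeriv hμ, ← lintegral_indicator hB, ← lintegral_indicator hB',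
    ← lintegral_sub_right_eq_self (μ := volume) ({z | u + z ∈ B}.indicator _) u]
  congr with x
  by_cases hxB : x ∈ B <;> simp [Set.indicator, hxB]

/-! ### Two-sided exponential noise and normalization of densities -/

/-- The density of the two-sided exponential law, up to normalization. -/
noncomputable def expAbs (b x : ℝ) : ℝ≥0∞ := ENNReal.ofReal (Real.exp (-(b * |x|)))

theorem measurable_expAbs (b : ℝ) : Measurable (expAbs b) := by
  unfold expAbs; fun_prop

theorem expAbs_ne_zero (b x : ℝ) : expAbs b x ≠ 0 := by
  simp [expAbs, Real.exp_pos]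

theorem expAbs_ne_top (b x : ℝ) : expAbs b x ≠ ⊤ := by
  simp [expAbs]

theorem expAbs_sub_le {b : ℝ} (hb : 0 ≤ b) (x u : ℝ) :
    expAbs b (x - u) ≤ ENNReal.ofReal (Real.exp (b * |u|)) * expAbs b x := by
  rw [expAbs, expAbs, ← ENNReal.ofReal_mul (Real.exp_pos _).le, ← Real.exp_add]
  gcongr
  have := abs_sub_abs_le_abs_sub x u
  nlinarith

theorem lintegral_one_add_sq_mul_expAbs_ne_top {b : ℝ} (hb : 0 < b) (m : ℝ) :
    ∫⁻ x, ENNReal.ofReal (1 + (x - m) ^ 2) * expAbs b x ≠ ⊤ := by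
  -- The fourth-order term of the exponential series, with 24 = 4!, absorbs both quadratic factors,
  -- leaving the integrable 1/(1 + x²).
  set K : ℝ := Real.exp (b * (1 + |m|)) * (24 / b ^ 4) with hK
  have hle : ∀ x : ℝ, (1 + (x - m) ^ 2) * Real.exp (-(b * |x|)) ≤ K * (1 + x ^ 2)⁻¹ := by
    intro x
    set y : ℝ := 1 + |m| + |x| with hy
    have hm := abs_nonneg m
    have hx := abs_nonneg x
    have hy0 : 0 < y := by positivity
    have h1 : 1 + (x - m) ^ 2 ≤ y ^ 2 := by
      have : |x - m| ≤ |x| + |m| := abs_sub x m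
      rw [← sq_abs (x - m)]
      nlinarith [abs_nonneg (x - m)]
    have h2 : 1 + x ^ 2 ≤ y ^ 2 := by
      rw [← sq_abs x]; nlinarith
    have h3 : y ^ 4 * Real.exp (-(b * y)) ≤ 24 / b ^ 4 := by
      have := Real.pow_div_factorial_le_exp (b * y) (by positivity) 4
      rw [Real.exp_neg, ← div_eq_mul_inv, div_le_div_iff₀ (Real.exp_pos _) (by positivity)]
      have h24 : ((Nat.factorial 4 : ℕ) : ℝ) = 24 := by norm_num [Nat.factorial]
      rw [h24, div_le_iff₀ (by norm_num)] at this
      nlinarith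
    rw [← div_eq_mul_inv, le_div_iff₀ (by positivity)]
    calc (1 + (x - m) ^ 2) * Real.exp (-(b * |x|)) * (1 + x ^ 2)
        ≤ y ^ 2 * Real.exp (-(b * |x|)) * y ^ 2 := by gcongr
      _ = Real.exp (b * (1 + |m|)) * (y ^ 4 * Real.exp (-(b * y))) := by
        have : Real.exp (-(b * |x|)) = Real.exp (b * (1 + |m|)) * Real.exp (-(b * y)) := by
          rw [← Real.exp_add]; congr 1; rw [hy]; ring
        rw [this]; ring
      _ ≤ K := by rw [hK]; gcongr
  have hint : Integrable fun x : ℝ => K * (1 + x ^ 2)⁻¹ := integrable_inv_one_add_sq.const_mul K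
  refine ne_top_of_le_ne_top hint.lintegral_lt_top.ne (lintegral_mono fun x => ?_)
  rw [expAbs, ← ENNReal.ofReal_mul (by positivity)]
  exact ENNReal.ofReal_le_ofReal (hle x)

/-- Normalizing and centring a density gives a noise law. -/
theorem exists_noise_of_density {q : ℝ → ℝ≥0∞} (hq : Measurable q) (m : ℝ)
    (h0 : ∫⁻ x, q x ≠ 0) (h2 : ∫⁻ x, ENNReal.ofReal (1 + (x - m) ^ 2) * q x ≠ ⊤) :
    ∃ ν : Measure ℝ, IsProbabilityMeasure ν ∧ MemLp (fun x : ℝ => x) 2 ν ∧ ∫ x, x ∂ν = 0 ∧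
      ENNReal.ofReal (∫ x, x ^ 2 ∂ν) * ∫⁻ x, q x ≤ ∫⁻ x, ENNReal.ofReal ((x - m) ^ 2) * q x ∧
      ∀ u c : ℝ, (∀ᵐ x, q (x - u) ≤ ENNReal.ofReal (Real.exp c) * q x) → ShiftBound ν u c := by
  set M := ∫⁻ x, q x with hM
  have hMtop : M ≠ ⊤ := by
    refine ne_top_of_le_ne_top h2 (lintegral_mono fun x => le_mul_of_one_le_left' ?_)
    rw [← ENNReal.ofReal_one]
    exact ENNReal.ofReal_le_ofReal (by nlinarith [sq_nonneg (x - m)])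
  set κ : Measure ℝ := M⁻¹ • volume.withDensity q with hκ
  have hκprob : IsProbabilityMeasure κ := ⟨by
    rw [hκ, Measure.smul_apply, withDensity_apply _ MeasurableSet.univ, Measure.restrict_univ,
      smul_eq_mul, ENNReal.inv_mul_cancel h0 hMtop]⟩
  have hκint : ∀ f : ℝ → ℝ≥0∞, Measurable f →
      ∫⁻ x, f x ∂κ = M⁻¹ * ∫⁻ x, f x * q x := by
    intro f hf
    rw [hκ, lintegral_smul_measure, lintegral_withDensity_eq_lintegral_mul _ hq hf, smul_eq_mul]
    simp [mul_comm]
  have hsq : ∫⁻ x, ENNReal.ofReal ((x - m) ^ 2) ∂κ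
      = M⁻¹ * ∫⁻ x, ENNReal.ofReal ((x - m) ^ 2) * q x := hκint _ (by fun_prop)
  have hsqtop : ∫⁻ x, ENNReal.ofReal ((x - m) ^ 2) ∂κ ≠ ⊤ := by
    rw [hsq]
    refine ENNReal.mul_ne_top (by simpa using h0) (ne_top_of_le_ne_top h2 ?_)
    gcongr
    linarith
  have hint : Integrable (fun x : ℝ => (x - m) ^ 2) κ :=
    (lintegral_ofReal_ne_top_iff_integrable (by fun_prop) (ae_of_all _ fun _ => sq_nonneg _)).1
      hsqtop
  have hLm : MemLp (fun x : ℝ => x - m) 2 κ := (memLp_two_iff_integrable_sq (by fun_prop)).2 hint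
  have hL : MemLp (fun x : ℝ => x) 2 κ := by
    exact (hLm.add (memLp_const m)).ae_eq (ae_of_all _ fun x => by simp)
  set a := ∫ x, x ∂κ with ha
  have hmeas : Measurable fun x : ℝ => x + -a := measurable_add_const _
  refine ⟨κ.map (· + -a), Measure.isProbabilityMeasure_map hmeas.aemeasurable, ?_, ?_, ?_, ?_⟩
  · rw [memLp_map_measure_iff (by fun_prop) hmeas.aemeasurable]
    exact hL.add (memLp_const (-a))
  · rw [integral_map hmeas.aemeasurable (by fun_prop),
      integral_add (hL.integrable (by norm_num)) (integrable_const _), ← ha]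
    simp
  · rw [integral_map hmeas.aemeasurable (by fun_prop)]
    -- Centring at the true mean `a` can only lower the second moment compared with centring at `m`.
    have hvar : ∫ x, (x + -a) ^ 2 ∂κ ≤ ∫ x, (x - m) ^ 2 ∂κ := by
      have e1 : ∫ x, (x + -a) ^ 2 ∂κ = Var[fun x : ℝ => x; κ] := by
        rw [variance_eq_integral (by fun_prop)]; simp [ha, sub_eq_add_neg]
      rw [e1, ← variance_sub_const (X := fun x : ℝ => x) (by fun_prop) m]
      exact variance_le_expectation_sq (by fun_prop)
    calc ENNReal.ofReal (∫ x, (x + -a) ^ 2 ∂κ) * M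
        ≤ ENNReal.ofReal (∫ x, (x - m) ^ 2 ∂κ) * M := by gcongr
      _ = M⁻¹ * (∫⁻ x, ENNReal.ofReal ((x - m) ^ 2) * q x) * M := by
        rw [ofReal_integral_eq_lintegral_ofReal hint (ae_of_all _ fun _ => sq_nonneg _), hsq]
      _ = (M⁻¹ * M) * (∫⁻ x, ENNReal.ofReal ((x - m) ^ 2) * q x) := by ring
      _ ≤ _ := by rw [ENNReal.inv_mul_cancel h0 hMtop, one_mul]
  · exact fun u c h => ((shiftBound_withDensity h).smul _).map_add_const _

/-- The centred two-sided exponential law. -/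
theorem exists_laplace_noise {b : ℝ} (hb : 0 < b) :
    ∃ ν : Measure ℝ, IsProbabilityMeasure ν ∧ MemLp (fun x : ℝ => x) 2 ν ∧ ∫ x, x ∂ν = 0 ∧
      ∀ u : ℝ, ShiftBound ν u (b * |u|) := by
  obtain ⟨ν, h1, h2, h3, -, h4⟩ := exists_noise_of_density (measurable_expAbs b) 0
    (by
      rw [Ne, lintegral_eq_zero_iff (measurable_expAbs b)]
      intro h
      obtain ⟨x, hx⟩ := h.exists
      exact expAbs_ne_zero b x hx)
    (lintegral_one_add_sq_mul_expAbs_ne_top hb 0)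
  exact ⟨ν, h1, h2, h3, fun u => h4 u _ (ae_of_all _ fun x => expAbs_sub_le hb.le x u)⟩

/-! ### Nearly optimal noise with a strictly better privacy parameter -/

/-- Pointwise convergence of the interpolated densities. Positivity of `g` matters because 0 ^ (1 -
s) is 0 for s < 1, not close to 1. -/
theorem tendsto_rpow_mul_rpow_one_sub {p g : ℝ≥0∞} (hp : p ≠ ⊤) (hg0 : g ≠ 0) (hg : g ≠ ⊤) :
    Filter.Tendsto (fun s : ℝ => p ^ s * g ^ (1 - s)) (nhdsWithin 1 (Set.Ioo 0 1)) (nhds p) := by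
  have key : ∀ a : ℝ≥0∞, a ≠ 0 → a ≠ ⊤ → ∀ f : ℝ → ℝ, Continuous f →
      Filter.Tendsto (fun s : ℝ => a ^ f s) (nhds 1) (nhds (a ^ f 1)) := by
    intro a h0 ht f hf
    lift a to NNReal using ht
    have h0' : a ≠ 0 := by simpa using h0
    simp_rw [← ENNReal.coe_rpow_of_ne_zero h0']
    have hc : ContinuousAt (fun s : ℝ => (a, f s)) 1 := by fun_prop
    exact ENNReal.tendsto_coe.2
      ((NNReal.continuousAt_rpow (x := a) (y := f 1) (Or.inl h0')).tendsto.comp hc.tendsto)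
  rcases eq_or_ne p 0 with rfl | hp0
  · refine tendsto_const_nhds.congr' ?_
    filter_upwards [self_mem_nhdsWithin] with s hs
    rw [ENNReal.zero_rpow_of_pos hs.1, zero_mul]
  · have h1 := key p hp0 hp (fun s => s) continuous_id
    have h2 := key g hg0 hg (fun s => 1 - s) (by fun_prop)
    have := ENNReal.Tendsto.mul h1 (by simp) h2 (by simp [hp])
    simp only [sub_self, ENNReal.rpow_zero, ENNReal.rpow_one, mul_one] at this
    exact this.mono_left nhdsWithin_le_nhds

theorem rpow_mul_rpow_one_sub_le (p g : ℝ≥0∞) {s : ℝ} (hs0 : 0 ≤ s) (hs1 : s ≤ 1) :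
    p ^ s * g ^ (1 - s) ≤ p + g := by
  have h1 : 0 ≤ 1 - s := by linarith
  calc p ^ s * g ^ (1 - s) ≤ (p + g) ^ s * (p + g) ^ (1 - s) := by
        gcongr
        · exact le_self_add
        · exact le_add_self
    _ = p + g := by
      rw [← ENNReal.rpow_add_of_nonneg _ _ hs0 h1]; simp

theorem ofReal_exp_rpow (c s : ℝ) :
    ENNReal.ofReal (Real.exp c) ^ s = ENNReal.ofReal (Real.exp (c * s)) := by
  rw [ENNReal.ofReal_rpow_of_pos (Real.exp_pos c), ← Real.exp_mul]

theorem exists_noiseDP_variance_lt {ε ξ : ℝ} (hε : 0 < ε) (hξ : 0 < ξ) :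
    ∃ μ : Measure ℝ, IsProbabilityMeasure μ ∧ NoiseDP ε μ ∧ MemLp (fun x : ℝ => x) 2 μ ∧
      Var[fun x : ℝ => x; μ] < optNoiseVar ε + ξ := by
  obtain ⟨ν, h1, h2, -, h4⟩ := exists_laplace_noise hε
  -- Without a witness the infimum would be the default value 0 of `sInf ∅`.
  have hne : {v : ℝ | ∃ μ : Measure ℝ, IsProbabilityMeasure μ ∧ NoiseDP ε μ ∧
      MemLp (fun x : ℝ => x) 2 μ ∧ v = Var[fun x : ℝ => x; μ]}.Nonempty :=
    ⟨_, ν, h1, noiseDP_iff_shiftBound.2 fun u hu => (h4 u).mono (by nlinarith), h2, rfl⟩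
  obtain ⟨v, ⟨μ, hμ1, hμ2, hμ3, rfl⟩, hlt⟩ := Real.lt_sInf_add_pos hne hξ
  exact ⟨μ, hμ1, hμ2, hμ3, hlt⟩

/-- Noise that is private with a slightly smaller parameter than `ε`, and whose variance is still
close to the optimum for `ε`: interpolate geometrically between the density of a nearly
optimal law and a two-sided exponential density. -/
theorem exists_noise_near_optimal {ε ξ : ℝ} (hε : 0 < ε) (hξ : 0 < ξ) :
    ∃ (ν : Measure ℝ) (ε' : ℝ), IsProbabilityMeasure ν ∧ ε' < ε ∧
      MemLp (fun x : ℝ => x) 2 ν ∧ ∫ x, x ∂ν = 0 ∧ ∫ x, x ^ 2 ∂ν ≤ optNoiseVar ε + ξ ∧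
      ∀ u : ℝ, |u| ≤ 1 → ShiftBound ν u ε' := by
  obtain ⟨μ, hμ1, hμ2, hμ3, hlt⟩ := exists_noiseDP_variance_lt hε hξ
  set p := μ.rnDeriv volume with hp
  have hpm : Measurable p := Measure.measurable_rnDeriv μ volume
  have hac := absolutelyContinuous_of_noiseDP hμ2
  have hwd : volume.withDensity p = μ := Measure.withDensity_rnDeriv_eq _ _ hac
  -- Any rate in (0, ε) would do: the interpolated exponent ε s + (ε/2)(1 - s) is below ε for every
  -- s < 1.
  set g := expAbs (ε / 2) with hg
  have hgm : Measurable g := measurable_expAbs _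
  set m := ∫ x, x ∂μ with hm
  have hmass : ∫⁻ x, p x = 1 := by
    rw [← setLIntegral_univ, ← withDensity_apply _ MeasurableSet.univ, hwd, measure_univ]
  have hsqint : Integrable (fun x : ℝ => (x - m) ^ 2) μ :=
    (hμ3.sub (memLp_const m)).integrable_sq
  have hvar : ∫⁻ x, ENNReal.ofReal ((x - m) ^ 2) * p x
      = ENNReal.ofReal Var[fun x : ℝ => x; μ] := by
    rw [variance_eq_integral (by fun_prop), ofReal_integral_eq_lintegral_ofReal hsqint
      (ae_of_all _ fun _ => sq_nonneg _)]
    conv_rhs => rw [← hwd, lintegral_withDensity_eq_lintegral_mul _ hpm (by fun_prop)]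
    simp [mul_comm, hm]
  have hgtop := lintegral_one_add_sq_mul_expAbs_ne_top (half_pos hε) m
  have hptop : ∫⁻ x, ENNReal.ofReal (1 + (x - m) ^ 2) * p x ≠ ⊤ := by
    have : ∀ x, ENNReal.ofReal (1 + (x - m) ^ 2) * p x
        = p x + ENNReal.ofReal ((x - m) ^ 2) * p x := by
      intro x
      rw [ENNReal.ofReal_add zero_le_one (sq_nonneg _), add_mul]; simp
    simp_rw [this]
    rw [lintegral_add_left hpm, hmass, hvar]
    simp
  have hsumtop : ∫⁻ x, ENNReal.ofReal (1 + (x - m) ^ 2) * (p x + g x) ≠ ⊤ := by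
    simp_rw [mul_add]
    rw [lintegral_add_left (by fun_prop)]
    exact ENNReal.add_ne_top.2 ⟨hptop, hgtop⟩
  let q : ℝ → ℝ → ℝ≥0∞ := fun s x => p x ^ s * g x ^ (1 - s)
  have hqm : ∀ s, Measurable (q s) := fun s => by fun_prop
  have hlim : ∀ f : ℝ → ℝ, Measurable f → (∀ x, f x ≤ 1 + (x - m) ^ 2) →
      Filter.Tendsto (fun s => ∫⁻ x, ENNReal.ofReal (f x) * q s x)
        (nhdsWithin 1 (Set.Ioo 0 1)) (nhds (∫⁻ x, ENNReal.ofReal (f x) * p x)) := by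
    intro f hf hf1
    refine tendsto_lintegral_filter_of_dominated_convergence
      (fun x => ENNReal.ofReal (1 + (x - m) ^ 2) * (p x + g x))
      (Filter.Eventually.of_forall fun s => by fun_prop) ?_ hsumtop ?_
    · filter_upwards [self_mem_nhdsWithin] with s hs
      refine ae_of_all _ fun x => ?_
      gcongr
      · exact hf1 x
      · exact rpow_mul_rpow_one_sub_le _ _ hs.1.le hs.2.le
    · filter_upwards [Measure.rnDeriv_lt_top μ volume] with x hx
      exact ENNReal.Tendsto.const_mul
        (tendsto_rpow_mul_rpow_one_sub hx.ne (expAbs_ne_zero _ _) (expAbs_ne_top _ _))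
        (Or.inr ENNReal.ofReal_ne_top)
  have hlim1 : Filter.Tendsto (fun s => ∫⁻ x, q s x)
      (nhdsWithin 1 (Set.Ioo 0 1)) (nhds 1) := by
    have := hlim (fun _ => 1) measurable_const (fun x => by nlinarith [sq_nonneg (x - m)])
    simpa [hmass] using this
  have hlim2 := hlim (fun x => (x - m) ^ 2) (by fun_prop) (fun x => by simp)
  rw [hvar] at hlim2
  have hlim3 : Filter.Tendsto (fun s => ENNReal.ofReal (optNoiseVar ε + ξ) * ∫⁻ x, q s x)
      (nhdsWithin 1 (Set.Ioo 0 1)) (nhds (ENNReal.ofReal (optNoiseVar ε + ξ) * 1)) :=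
    ENNReal.Tendsto.const_mul hlim1 (Or.inr ENNReal.ofReal_ne_top)
  have hpos : 0 < optNoiseVar ε + ξ := (variance_nonneg _ _).trans_lt hlt
  have hlt' : ENNReal.ofReal Var[fun x : ℝ => x; μ] < ENNReal.ofReal (optNoiseVar ε + ξ) * 1 := by
    rw [mul_one]; exact (ENNReal.ofReal_lt_ofReal_iff hpos).2 hlt
  have : (nhdsWithin (1 : ℝ) (Set.Ioo 0 1)).NeBot := right_nhdsWithin_Ioo_neBot zero_lt_one
  have hev : ∀ᶠ s in nhdsWithin (1 : ℝ) (Set.Ioo 0 1), s ∈ Set.Ioo (0 : ℝ) 1 :=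
    self_mem_nhdsWithin
  -- As s → 1 the mass tends to 1 and the second moment about `m` to the variance of `μ`, which is
  -- strictly below the target; some s < 1 keeps that inequality.
  obtain ⟨s, hs, hs0, hs1, hs2⟩ := (hev.and ((hlim1.eventually_ne one_ne_zero).and
    ((hlim1.eventually_ne ENNReal.one_ne_top).and (hlim2.eventually_lt hlim3 hlt')))).exists
  obtain ⟨ν, h1, h2, h3, h4, h5⟩ := exists_noise_of_density (hqm s) m hs0
    (ne_top_of_le_ne_top hsumtop (lintegral_mono fun x => by
      gcongr; exact rpow_mul_rpow_one_sub_le _ _ hs.1.le hs.2.le))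
  refine ⟨ν, ε * s + ε / 2 * (1 - s), h1, by nlinarith [hs.2], h2, h3, ?_, fun u hu => h5 u _ ?_⟩
  · have := (ENNReal.mul_lt_mul_iff_left hs0 hs1).1 (h4.trans_lt hs2)
    exact ((ENNReal.ofReal_lt_ofReal_iff hpos).1 this).le
  · filter_upwards [rnDeriv_sub_le_of_shiftBound hac (noiseDP_iff_shiftBound.1 hμ2 u hu)] with x hx
    have hg' : g (x - u) ≤ ENNReal.ofReal (Real.exp (ε / 2)) * g x := by
      refine (expAbs_sub_le (half_pos hε).le x u).trans ?_
      gcongr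
      nlinarith
    have hs' : 0 ≤ 1 - s := by linarith [hs.2]
    calc p (x - u) ^ s * g (x - u) ^ (1 - s)
        ≤ (ENNReal.ofReal (Real.exp ε) * p x) ^ s
          * (ENNReal.ofReal (Real.exp (ε / 2)) * g x) ^ (1 - s) := by
          gcongr
          exact hs.1.le
      _ = ENNReal.ofReal (Real.exp (ε * s + ε / 2 * (1 - s))) * q s x := by
        rw [ENNReal.mul_rpow_of_nonneg _ _ hs.1.le, ENNReal.mul_rpow_of_nonneg _ _ hs',
          ofReal_exp_rpow, ofReal_exp_rpow, Real.exp_add, ENNReal.ofReal_mul (Real.exp_pos _).le]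
        simp only [q]
        ring

/-! ### Shifts of product measures -/

/-- The bounds of the coordinates add up in a product. -/
theorem ShiftBound.pi {ι : Type*} [Fintype ι] {μ : ι → Measure ℝ} [∀ i, SigmaFinite (μ i)]
    {u c : ι → ℝ} (h : ∀ i, ShiftBound (μ i) (u i) (c i)) :
    ShiftBound (Measure.pi μ) u (∑ i, c i) := by
  intro B hB
  set K : ℝ≥0∞ := ENNReal.ofReal (Real.exp (∑ i, c i)) with hK
  have hK0 : K ≠ 0 := by simp [hK, Real.exp_pos]
  have hKtop : K ≠ ⊤ := by simp [hK]
  have hm : Measurable fun z : ι → ℝ => u + z := measurable_const_add u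
  -- The product outer measure is the largest one bounded by the product of the sides on every box,
  -- so the comparison need only be made on boxes. The sides are arbitrary sets, hence the passage
  -- to measurable hulls.
  have hle : (K⁻¹ • (Measure.pi μ).map (u + ·)).toOuterMeasure
      ≤ OuterMeasure.pi fun i => (μ i).toOuterMeasure := by
    rw [OuterMeasure.le_pi]
    intro s _
    have hbox : (Measure.pi μ).map (u + ·) (Set.univ.pi s) ≤ K * ∏ i, μ i (s i) := by
      calc (Measure.pi μ).map (u + ·) (Set.univ.pi s)
          ≤ (Measure.pi μ).map (u + ·) (Set.univ.pi fun i => toMeasurable (μ i) (s i)) :=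
            measure_mono (Set.pi_mono fun i _ => subset_toMeasurable _ _)
        _ = ∏ i, μ i {z | u i + z ∈ toMeasurable (μ i) (s i)} := by
            rw [Measure.map_apply hm
              (MeasurableSet.univ_pi fun i => measurableSet_toMeasurable _ _), ← Measure.pi_pi]
            congr 1
        _ ≤ ∏ i, (ENNReal.ofReal (Real.exp (c i)) * μ i (s i)) := by
            gcongr with i
            refine (h i _ (measurableSet_toMeasurable _ _)).trans ?_
            rw [measure_toMeasurable]
        _ = K * ∏ i, μ i (s i) := by
            rw [Finset.prod_mul_distrib, hK, Real.exp_sum,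
              ENNReal.ofReal_prod_of_nonneg fun i _ => (Real.exp_pos _).le]
    change K⁻¹ * (Measure.pi μ).map (u + ·) (Set.univ.pi s) ≤ _
    calc K⁻¹ * (Measure.pi μ).map (u + ·) (Set.univ.pi s) ≤ K⁻¹ * (K * ∏ i, μ i (s i)) := by gcongr
      _ = _ := by rw [← mul_assoc, ENNReal.inv_mul_cancel hK0 hKtop, one_mul]; rfl
  have h1 : K⁻¹ * Measure.pi μ {z | u + z ∈ B} ≤ Measure.pi μ B := by
    have := hle B
    rw [Measure.pi, toMeasure_apply _ _ hB, ← Measure.pi]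
    refine le_trans (le_of_eq ?_) this
    change _ = K⁻¹ * (Measure.pi μ).map (u + ·) B
    rw [Measure.map_apply hm hB]
    rfl
  calc Measure.pi μ {z | u + z ∈ B} = K * (K⁻¹ * Measure.pi μ {z | u + z ∈ B}) := by
        rw [← mul_assoc, ENNReal.mul_inv_cancel hK0 hKtop, one_mul]
    _ ≤ _ := by gcongr

/-! ### The consistency decoder -/

section Decoder

variable {N : ℕ} (w : Finset (Fin N) → Fin N → ℝ) (k m : ℕ)

/-- The linear estimate from the symbols of the nodes in `K`. -/
noncomputable def estimate (K : Finset (Fin N)) (c : Fin N → ℝ) : ℝ := ∑ i ∈ K, w K i * c i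

/-- The total disagreement of the estimates from `k`-subsets of `H`. -/
noncomputable def spread (H : Finset (Fin N)) (c : Fin N → ℝ) : ℝ :=
  ∑ K ∈ H.powersetCard k, ∑ K' ∈ H.powersetCard k, |estimate w K c - estimate w K' c|

/-- The symbols of a word, with zeros for the erasures. -/
def fillZero (y : Fin N → Option ℝ) (i : Fin N) : ℝ := (y i).getD 0

/-- The sets of `m` received nodes with the least disagreement. -/
def mostConsistent (y : Fin N → Option ℝ) : Set (Finset (Fin N)) :=
  {H | H ∈ (received y).powersetCard m ∧
    ∀ H' ∈ (received y).powersetCard m, spread w k H (fillZero y) ≤ spread w k H' (fillZero y)}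

open Classical in
/-- A choice of `k` nodes in one of the sets of the family `M`, or in `F` if there are none. -/
noncomputable def pick (F : Finset (Fin N)) (M : Set (Finset (Fin N))) : Finset (Fin N) :=
  if h : ∃ K : Finset (Fin N), K.card = k ∧ ∃ H ∈ M, K ⊆ H then h.choose
  else if h : ∃ K : Finset (Fin N), K.card = k ∧ K ⊆ F then h.choose else ∅

/-- The nodes that the decoder selects: `k` nodes out of a most consistent set of `m` nodes. -/
noncomputable def select (y : Fin N → Option ℝ) : Finset (Fin N) :=
  pick k (received y) (mostConsistent w k m y)

/-- The error-decoding rule. -/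
noncomputable def decode (y : Fin N → Option ℝ) : ℝ := estimate w (select w k m y) (fillZero y)

variable {w k m}

theorem pick_of_exists {F : Finset (Fin N)} {M : Set (Finset (Fin N))}
    (h : ∃ K : Finset (Fin N), K.card = k ∧ ∃ H ∈ M, K ⊆ H) :
    (pick k F M).card = k ∧ ∃ H ∈ M, pick k F M ⊆ H := by
  rw [pick, dif_pos h]; exact h.choose_spec

theorem select_spec {y : Fin N → Option ℝ} (hy : k ≤ (received y).card) :
    select w k m y ⊆ received y ∧ (select w k m y).card = k := by
  by_cases h : ∃ K : Finset (Fin N), K.card = k ∧ ∃ H ∈ mostConsistent w k m y, K ⊆ H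
  · obtain ⟨h1, H, hH, h2⟩ := pick_of_exists (F := received y) h
    exact ⟨h2.trans (Finset.mem_powersetCard.1 hH.1).1, h1⟩
  · have h' : ∃ K : Finset (Fin N), K.card = k ∧ K ⊆ received y := by
      obtain ⟨K, h1, h2⟩ := Finset.exists_subset_card_eq hy
      exact ⟨K, h2, h1⟩
    rw [select, pick, dif_neg h, dif_pos h']
    exact ⟨h'.choose_spec.2, h'.choose_spec.1⟩

theorem measurable_estimate (K : Finset (Fin N)) : Measurable (estimate w K) := by
  unfold estimate; fun_prop

theorem measurable_spread (H : Finset (Fin N)) : Measurable (spread w k H) := by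
  unfold spread
  refine Finset.measurable_fun_sum _ fun K _ => Finset.measurable_fun_sum _ fun K' _ => ?_
  have := measurable_estimate (w := w) K
  have := measurable_estimate (w := w) K'
  fun_prop

/-- On a fixed erasure pattern the selection depends only on which sets are most consistent. This
leaves finitely many cases, cut out by inequalities between spreads, and the output is linear on
each. -/
theorem measurable_decode (F : Finset (Fin N)) :
    Measurable fun y : Fin N → ℝ => decode w k m fun i => if i ∈ F then none else some (y i) := by
  classical
  set word : (Fin N → ℝ) → Fin N → Option ℝ := fun y i => if i ∈ F then none else some (y i)
    with hword
  have hfill : Measurable fun y => fillZero (word y) := by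
    refine measurable_pi_lambda _ fun i => ?_
    by_cases hi : i ∈ F
    · simp [fillZero, hword, hi]
    · simp only [fillZero, hword, hi, if_false, Option.getD_some]; fun_prop
  have hrec : ∀ y, received (word y) = Fᶜ := by
    intro y; ext i; by_cases hi : i ∈ F <;> simp [received, hword, hi]
  have hmem : ∀ H, MeasurableSet {y | H ∈ mostConsistent w k m (word y)} := by
    intro H
    have : {y | H ∈ mostConsistent w k m (word y)} = {_y | H ∈ Fᶜ.powersetCard m} ∩
        ⋂ H' ∈ Fᶜ.powersetCard m,
          {y | spread w k H (fillZero (word y)) ≤ spread w k H' (fillZero (word y))} := by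
      ext y; simp [mostConsistent, hrec]
    rw [this]
    refine (MeasurableSet.const _).inter (Finset.measurableSet_biInter _ fun H' _ => ?_)
    exact measurableSet_le ((measurable_spread H).comp hfill) ((measurable_spread H').comp hfill)
  have hmost : ∀ M, MeasurableSet {y | mostConsistent w k m (word y) = M} := by
    intro M
    have : {y | mostConsistent w k m (word y) = M}
        = ⋂ H, {y | H ∈ mostConsistent w k m (word y) ↔ H ∈ M} := by
      ext y; simp [Set.ext_iff]
    rw [this]
    refine MeasurableSet.iInter fun H => ?_
    by_cases hH : H ∈ M
    · simpa only [hH, iff_true] using hmem H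
    · simp only [hH, iff_false]
      exact (hmem H).compl
  have hsel : ∀ K, MeasurableSet {y | select w k m (word y) = K} := by
    intro K
    have : {y | select w k m (word y) = K}
        = ⋃ M : {M : Set (Finset (Fin N)) // pick k Fᶜ M = K},
          {y | mostConsistent w k m (word y) = M} := by
      ext y; simp [select, hrec]
    rw [this]
    exact MeasurableSet.iUnion fun M => hmost M
  have hdec : (fun y => decode w k m (word y)) = fun y => ∑ K : Finset (Fin N),
      {y | select w k m (word y) = K}.indicator (fun y => estimate w K (fillZero (word y))) y := by
    ext y
    rw [Finset.sum_eq_single (select w k m (word y))]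
    · simp [decode]
    · intro K _ hK; simp [Set.indicator, hK.symm]
    · simp
  rw [hdec]
  exact Finset.measurable_fun_sum _ fun K _ =>
    ((measurable_estimate K).comp hfill).indicator (hsel K)

theorem abs_estimate_sub_le_spread {H K K' : Finset (Fin N)} {c : Fin N → ℝ}
    (hK : K ⊆ H) (hKc : K.card = k) (hK' : K' ⊆ H) (hKc' : K'.card = k) :
    |estimate w K c - estimate w K' c| ≤ spread w k H c := by
  have h1 := Finset.single_le_sum (f := fun K' => |estimate w K c - estimate w K' c|)
    (fun _ _ => abs_nonneg _) (Finset.mem_powersetCard.2 ⟨hK', hKc'⟩)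
  have h2 := Finset.single_le_sum
    (f := fun K => ∑ K' ∈ H.powersetCard k, |estimate w K c - estimate w K' c|)
    (fun _ _ => Finset.sum_nonneg fun _ _ => abs_nonneg _) (Finset.mem_powersetCard.2 ⟨hK, hKc⟩)
  exact h1.trans h2

theorem spread_nonneg (H : Finset (Fin N)) (c : Fin N → ℝ) : 0 ≤ spread w k H c :=
  Finset.sum_nonneg fun _ _ => Finset.sum_nonneg fun _ _ => abs_nonneg _

theorem spread_mono {H H' : Finset (Fin N)} (h : H ⊆ H') (c : Fin N → ℝ) :
    spread w k H c ≤ spread w k H' c := by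
  have hp := Finset.powersetCard_mono (n := k) h
  refine (Finset.sum_le_sum fun K _ => ?_).trans (Finset.sum_le_sum_of_subset_of_nonneg hp
    fun K _ _ => Finset.sum_nonneg fun _ _ => abs_nonneg _)
  exact Finset.sum_le_sum_of_subset_of_nonneg hp fun K _ _ => abs_nonneg _

theorem estimate_congr {K : Finset (Fin N)} {c c' : Fin N → ℝ} (h : ∀ i ∈ K, c i = c' i) :
    estimate w K c = estimate w K c' :=
  Finset.sum_congr rfl fun i hi => by rw [h i hi]

theorem spread_congr {H : Finset (Fin N)} {c c' : Fin N → ℝ} (h : ∀ i ∈ H, c i = c' i) :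
    spread w k H c = spread w k H c' := by
  have he : ∀ K ∈ H.powersetCard k, estimate w K c = estimate w K c' := fun K hK =>
    estimate_congr fun i hi => h i ((Finset.mem_powersetCard.1 hK).1 hi)
  exact Finset.sum_congr rfl fun K hK => Finset.sum_congr rfl fun K' hK' => by
    rw [he K hK, he K' hK']

/-- Whatever the adversarial nodes show, the decoder's output is as close to the estimates from
correct symbols as these are to each other. -/
theorem abs_decode_sub_le {E A : ℕ} (hN : k + E + 2 * A ≤ N) {Er Ad : Finset (Fin N)}
    (hEr : Er.card ≤ E) (hAd : Ad.card ≤ A) {c : Fin N → ℝ} {y : Fin N → Option ℝ}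
    (hy : y ∈ words c Er Ad) {K₀ : Finset (Fin N)} (hK₀ : K₀.card = k) :
    |decode w k (k + A) y - estimate w K₀ c| ≤ 2 * spread w k Finset.univ c := by
  set G : Finset (Fin N) := (Er ∪ Ad)ᶜ with hG
  have hyG : ∀ i ∈ G, y i = some (c i) := fun i hi => by
    simp only [hG, Finset.mem_compl, Finset.mem_union, not_or] at hi
    exact hy.1 i hi.1 hi.2
  have hGrec : G ⊆ received y := fun i hi => by simp [received, hyG i hi]
  have hGfill : ∀ i ∈ G, fillZero y i = c i := fun i hi => by simp [fillZero, hyG i hi]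
  -- Here N ≥ k + E + 2A enters: one A pays for the adversaries, the other makes the consistent set
  -- large enough to contain k correct symbols despite them.
  have hGcard : k + A ≤ G.card := by
    have h1 := Finset.card_union_le Er Ad
    have h2 := Finset.card_compl (Er ∪ Ad)
    rw [Fintype.card_fin, ← hG] at h2
    omega
  obtain ⟨H₀, hH₀G, hH₀⟩ := Finset.exists_subset_card_eq hGcard
  have hH₀mem : H₀ ∈ (received y).powersetCard (k + A) :=
    Finset.mem_powersetCard.2 ⟨hH₀G.trans hGrec, hH₀⟩
  obtain ⟨H₁, hH₁, hmin⟩ := Finset.exists_min_image ((received y).powersetCard (k + A))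
    (fun H => spread w k H (fillZero y)) ⟨H₀, hH₀mem⟩
  have hH₁card := (Finset.mem_powersetCard.1 hH₁).2
  have hex : ∃ K : Finset (Fin N), K.card = k ∧ ∃ H ∈ mostConsistent w k (k + A) y, K ⊆ H := by
    obtain ⟨K, hK, hKc⟩ := Finset.exists_subset_card_eq (s := H₁) (n := k) (by omega)
    exact ⟨K, hKc, H₁, ⟨hH₁, hmin⟩, hK⟩
  obtain ⟨hKc, H, hH, hKH⟩ := pick_of_exists (F := received y) hex
  have hHcard := (Finset.mem_powersetCard.1 hH.1).2
  have hHrec := (Finset.mem_powersetCard.1 hH.1).1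
  have hHG : H \ Ad ⊆ G := by
    intro i hi
    rw [Finset.mem_sdiff] at hi
    simp only [hG, Finset.mem_compl, Finset.mem_union, not_or]
    refine ⟨fun hiE => ?_, hi.2⟩
    have := hHrec hi.1
    simp [received, hy.2 i hiE] at this
  -- At most A of the k + A nodes in `H` are adversarial, so k correct ones remain for comparison
  -- with the selected set; minimality bounds the spread of `H` by that of the correct set `H₀`.
  obtain ⟨K', hK', hKc'⟩ := Finset.exists_subset_card_eq (s := H \ Ad) (n := k) (by
    have := Finset.le_card_sdiff Ad H
    omega)
  have h1 : |decode w k (k + A) y - estimate w K' (fillZero y)| ≤ spread w k Finset.univ c := by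
    calc _ ≤ spread w k H (fillZero y) :=
          abs_estimate_sub_le_spread hKH hKc (hK'.trans Finset.sdiff_subset) hKc'
      _ ≤ spread w k H₀ (fillZero y) := hH.2 H₀ hH₀mem
      _ = spread w k H₀ c := spread_congr fun i hi => hGfill i (hH₀G hi)
      _ ≤ _ := spread_mono (Finset.subset_univ _) c
  rw [estimate_congr fun i hi => hGfill i (hHG (hK' hi))] at h1
  have h2 : |estimate w K' c - estimate w K₀ c| ≤ spread w k Finset.univ c :=
    abs_estimate_sub_le_spread (Finset.subset_univ _) hKc' (Finset.subset_univ _) hK₀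
  calc _ ≤ |decode w k (k + A) y - estimate w K' c| + |estimate w K' c - estimate w K₀ c| :=
        abs_sub_le _ _ _
    _ ≤ _ := by linarith

end Decoder

/-! ### The scheme attached to a noise law and a weight system -/

/-- The scheme with independent noise vectors of the same law `P`, and the error-decoding rule. -/
noncomputable def codeScheme {N : ℕ} (P : Measure (Fin N → ℝ)) [IsProbabilityMeasure P]
    (hint : ∀ i, Integrable (fun r => r i) P) (hmean : ∀ i, ∫ r, r i ∂P = 0)
    (w : Finset (Fin N) → Fin N → ℝ) (k m : ℕ) : Scheme N where
  noise := P.prod P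
  dec := decode w k m
  isProb := inferInstance
  integrable_fst i := (hint i).comp_fst P
  integrable_snd i := (hint i).comp_snd P
  mean_fst i := by
    rw [integral_fun_fst (fun r : Fin N → ℝ => r i), hmean, smul_zero]
  mean_snd i := by
    rw [integral_fun_snd (fun r : Fin N → ℝ => r i), hmean, smul_zero]
  indep := indepFun_prod measurable_id measurable_id
  measurable_dec := measurable_decode

variable {N : ℕ} {P : Measure (Fin N → ℝ)} [IsProbabilityMeasure P]
  {hint : ∀ i, Integrable (fun r => r i) P} {hmean : ∀ i, ∫ r, r i ∂P = 0}
  {w : Finset (Fin N) → Fin N → ℝ} {k : ℕ}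

theorem codeScheme_selectsThenLinear {m : ℕ} :
    (codeScheme P hint hmean w k m).SelectsThenLinear k :=
  ⟨select w k m, w, fun _ hy => ⟨(select_spec hy).1, (select_spec hy).2, rfl⟩⟩

theorem codeScheme_nodeDP {T m : ℕ} {ε : ℝ}
    (h : ∀ a a' : ℝ, |a - a'| ≤ 1 → ∀ 𝒯 : Finset (Fin N), 𝒯.card = T →
      ∀ B : Set (𝒯 → ℝ), MeasurableSet B → P {r | (fun t : 𝒯 => a + r t) ∈ B} ≤
        ENNReal.ofReal (Real.exp ε) * P {r | (fun t : 𝒯 => a' + r t) ∈ B}) :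
    (codeScheme P hint hmean w k m).NodeDP T ε := by
  intro a₀ b₀ a₁ b₁ ha hb 𝒯 h𝒯 B hB
  have hm : ∀ (a : ℝ), MeasurableSet {r : Fin N → ℝ | (fun t : 𝒯 => a + r t) ∈ B} := fun a =>
    (measurable_pi_lambda _ fun t : 𝒯 => by fun_prop :
      Measurable fun (r : Fin N → ℝ) (t : 𝒯) => a + r t) hB
  have hfst : ∀ a : ℝ, (P.prod P) {ω | (fun t : 𝒯 => a + ω.1 t) ∈ B}
      = P {r | (fun t : 𝒯 => a + r t) ∈ B} := fun a =>
    (measurePreserving_fst (μ := P) (ν := P)).measure_preimage (hm a).nullMeasurableSet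
  have hsnd : ∀ a : ℝ, (P.prod P) {ω | (fun t : 𝒯 => a + ω.2 t) ∈ B}
      = P {r | (fun t : 𝒯 => a + r t) ∈ B} := fun a =>
    (measurePreserving_snd (μ := P) (ν := P)).measure_preimage (hm a).nullMeasurableSet
  change (P.prod P) _ ≤ _ * (P.prod P) _ ∧ (P.prod P) _ ≤ _ * (P.prod P) _
  rw [hfst, hfst, hsnd, hsnd]
  exact ⟨h a₀ a₁ ha 𝒯 h𝒯 B hB, h b₀ b₁ hb 𝒯 h𝒯 B hB⟩

/-- The error of the code scheme is controlled by that of the estimate from the correct symbols of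
any `k` nodes, and by the disagreement of all such estimates. -/
theorem codeScheme_mse_le {E A : ℕ} (hN : k + E + 2 * A ≤ N) (α β : Measure ℝ)
    {K₀ : Finset (Fin N)} (hK₀ : K₀.card = k) :
    (codeScheme P hint hmean w k (k + A)).mse E A α β ≤
      ∫⁻ ω, ENNReal.ofReal
        ((|estimate w K₀ (fun i => (ω.1.1 + ω.2.1 i) * (ω.1.2 + ω.2.2 i)) - ω.1.1 * ω.1.2| +
          2 * spread w k Finset.univ (fun i => (ω.1.1 + ω.2.1 i) * (ω.1.2 + ω.2.2 i))) ^ 2)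
        ∂((α.prod β).prod (P.prod P)) := by
  refine iSup_le fun Er => iSup_le fun Ad => iSup_le fun hEr => iSup_le fun hAd => ?_
  -- The integrand of the bound serves as the measurable majorant, so measurability of the supremum
  -- over words is not needed.
  refine iInf_le_of_le _ (iInf_le_of_le ?_ (iInf_le_of_le ?_ le_rfl))
  · have hc : Measurable fun ω : (ℝ × ℝ) × (Fin N → ℝ) × (Fin N → ℝ) =>
        fun i => (ω.1.1 + ω.2.1 i) * (ω.1.2 + ω.2.2 i) := by fun_prop
    have h1 := (measurable_estimate (w := w) K₀).comp hc
    have h2 := (measurable_spread (w := w) (k := k) Finset.univ).comp hc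
    simp only [Function.comp_def] at h1 h2
    fun_prop
  · intro ω
    refine iSup₂_le fun y hy => ENNReal.ofReal_le_ofReal ?_
    rw [← sq_abs]
    gcongr
    have h1 := abs_decode_sub_le (w := w) hN hEr hAd hy hK₀
    have h2 := abs_sub_le (decode w k (k + A) y)
      (estimate w K₀ fun i => (ω.1.1 + ω.2.1 i) * (ω.1.2 + ω.2.2 i)) (ω.1.1 * ω.1.2)
    change |decode w k (k + A) y - ω.1.1 * ω.1.2| ≤ _
    linarith

/-! ### The polynomial code: weights, estimates and colluding nodes -/

section Code

variable {N : ℕ} (t : ℕ) (κ τ : ℝ)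

theorem node_injOn (K : Finset (Fin N)) : Set.InjOn (fun i : Fin N => (i : ℝ)) K :=
  fun _ _ _ _ h => Fin.ext (Nat.cast_injective (R := ℝ) h)

/-- Lagrange weights compute the coefficients of polynomials of low degree. -/
theorem sum_basis_coeff_mul_pow (K : Finset (Fin N)) {j : ℕ} (hj : j < K.card) (l : ℕ) :
    ∑ i ∈ K, (Lagrange.basis K (fun i : Fin N => (i : ℝ)) i).coeff l * (i : ℝ) ^ j
      = if l = j then 1 else 0 := by
  have h := Lagrange.eq_interpolate (f := (Polynomial.X : Polynomial ℝ) ^ j) (node_injOn K)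
    (by rw [Polynomial.degree_X_pow]; exact_mod_cast hj)
  have h' := congrArg (fun f => Polynomial.coeff f l) h
  simp only [Polynomial.coeff_X_pow, Lagrange.interpolate_apply, Polynomial.finsetSum_coeff,
    Polynomial.coeff_C_mul, Polynomial.eval_pow, Polynomial.eval_X] at h'
  rw [h']
  exact Finset.sum_congr rfl fun i _ => mul_comm _ _

/-- The coefficients of the polynomial that interpolates `x ^ (t + 1)` at the nodes of `𝒯`. -/
noncomputable def interpCoeff (𝒯 : Finset (Fin N)) (j : ℕ) : ℝ :=
  (Lagrange.interpolate 𝒯 (fun i : Fin N => (i : ℝ)) fun i => (i : ℝ) ^ (t + 1)).coeff j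

theorem sum_interpCoeff {𝒯 : Finset (Fin N)} (h𝒯 : 𝒯.card = t + 1) {i : Fin N} (hi : i ∈ 𝒯) :
    ∑ j : Fin (t + 1), interpCoeff t 𝒯 j * (i : ℝ) ^ (j : ℕ) = (i : ℝ) ^ (t + 1) := by
  have h := Lagrange.eval_interpolate_at_node (fun i : Fin N => (i : ℝ) ^ (t + 1))
    (node_injOn 𝒯) hi
  have hdeg := Lagrange.degree_interpolate_lt (fun i : Fin N => (i : ℝ) ^ (t + 1)) (node_injOn 𝒯)
  rw [h𝒯] at hdeg
  have hnat : (Lagrange.interpolate 𝒯 (fun i : Fin N => (i : ℝ))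
      fun i => (i : ℝ) ^ (t + 1)).natDegree < t + 1 := by
    by_cases h0 : Lagrange.interpolate 𝒯 (fun i : Fin N => (i : ℝ))
        (fun i => (i : ℝ) ^ (t + 1)) = 0
    · rw [h0]; simp
    · exact (Polynomial.natDegree_lt_iff_degree_lt h0).2 hdeg
  rw [Polynomial.eval_eq_sum_range' hnat, Finset.sum_range] at h
  exact h

/-- The deviation of the noise coefficients from those of the first noise variable alone. -/
noncomputable def pert (i : Fin N) (j : Fin (t + 1)) : ℝ :=
  if j = 0 then τ * ((i : ℝ) ^ (t + 1) + κ) else (i : ℝ) ^ (j : ℕ)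

/-- The coefficient of the `j`-th noise variable at the node `i`. -/
noncomputable def noiseCoeff (i : Fin N) (j : Fin (t + 1)) : ℝ :=
  (if j = 0 then 1 else 0) + τ ^ 2 * pert t κ τ i j

/-- The noise vector as a function of the noise variables. -/
noncomputable def noiseMap (X : Fin (t + 1) → ℝ) (i : Fin N) : ℝ :=
  ∑ j, noiseCoeff t κ τ i j * X j

/-- The decoding weights. -/
noncomputable def weight (c₁ c₂ : ℝ) (K : Finset (Fin N)) (i : Fin N) : ℝ :=
  c₁ * (Lagrange.basis K (fun i : Fin N => (i : ℝ)) i).coeff 0 +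
    (c₂ / τ ^ 3 - κ * c₁) * (Lagrange.basis K (fun i : Fin N => (i : ℝ)) i).coeff (t + 1)

theorem measurable_noiseMap : Measurable (noiseMap t κ τ : _ → Fin N → ℝ) := by
  unfold noiseMap; fun_prop

variable {t κ τ}

theorem sum_weight_mul_pow (c₁ c₂ : ℝ) {K : Finset (Fin N)} (hK : K.card = t + 2) {j : ℕ}
    (hj : j ≤ t + 1) : ∑ i ∈ K, weight t κ τ c₁ c₂ K i * (i : ℝ) ^ j
      = c₁ * (if 0 = j then 1 else 0) + (c₂ / τ ^ 3 - κ * c₁) * (if t + 1 = j then 1 else 0) := by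
  rw [← sum_basis_coeff_mul_pow K (by omega : j < K.card),
    ← sum_basis_coeff_mul_pow K (by omega : j < K.card), Finset.mul_sum, Finset.mul_sum,
    ← Finset.sum_add_distrib]
  exact Finset.sum_congr rfl fun i _ => by unfold weight; ring

theorem sum_weight (c₁ c₂ : ℝ) {K : Finset (Fin N)} (hK : K.card = t + 2) :
    ∑ i ∈ K, weight t κ τ c₁ c₂ K i = c₁ := by
  simpa using sum_weight_mul_pow (κ := κ) (τ := τ) c₁ c₂ hK (Nat.zero_le _)

/-- The term -κ c₁ in `weight` cancels the contribution of κ in `pert`, and 1/τ³ compensates τ²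
times the extra τ in the zeroth coefficient. -/
theorem sum_weight_mul_pert (hτ : τ ≠ 0) (c₁ c₂ : ℝ) {K : Finset (Fin N)} (hK : K.card = t + 2)
    (j : Fin (t + 1)) : τ ^ 2 * ∑ i ∈ K, weight t κ τ c₁ c₂ K i * pert t κ τ i j
      = if j = 0 then c₂ else 0 := by
  by_cases hj : j = 0
  · have h1 := sum_weight_mul_pow (κ := κ) (τ := τ) c₁ c₂ hK le_rfl
    have h0 := sum_weight (κ := κ) (τ := τ) c₁ c₂ hK
    simp only [pert, hj, if_true]
    have : ∀ i : Fin N, weight t κ τ c₁ c₂ K i * (τ * ((i : ℝ) ^ (t + 1) + κ)) =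
      τ * (weight t κ τ c₁ c₂ K i * (i : ℝ) ^ (t + 1)) + τ * κ * weight t κ τ c₁ c₂ K i :=
      fun i => by ring
    simp_rw [this]
    rw [Finset.sum_add_distrib, ← Finset.mul_sum, ← Finset.mul_sum, h1, h0]
    simp
    field_simp
    ring
  · have hj' : (j : ℕ) ≠ 0 := fun h => hj (Fin.ext h)
    have h1 := sum_weight_mul_pow (κ := κ) (τ := τ) c₁ c₂ hK (j := j) (by omega)
    simp only [pert, hj, if_false]
    rw [h1, if_neg hj'.symm, if_neg (by omega)]
    simp

theorem noiseMap_eq (X : Fin (t + 1) → ℝ) (i : Fin N) :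
    noiseMap t κ τ X i = X 0 + τ ^ 2 * ∑ j, pert t κ τ i j * X j := by
  simp [noiseMap, noiseCoeff, add_mul, Finset.sum_add_distrib, Finset.mul_sum, mul_assoc]

/-- The first-order terms collapse to multiples of `X 0` and `Y 0`. The remainder combines τ⁴ from
the two perturbations with weights of order τ⁻³, hence its form τ · (τ³ · weight). -/
theorem estimate_eq (hτ : τ ≠ 0) (c₁ c₂ : ℝ) {K : Finset (Fin N)} (hK : K.card = t + 2)
    (a b : ℝ) (X Y : Fin (t + 1) → ℝ) :
    estimate (weight t κ τ c₁ c₂) K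
        (fun i => (a + noiseMap t κ τ X i) * (b + noiseMap t κ τ Y i))
      = c₁ * (a * b) + (c₁ + c₂) * (a * Y 0 + b * X 0) + (c₁ + 2 * c₂) * (X 0 * Y 0) +
        τ * ∑ i ∈ K, τ ^ 3 * weight t κ τ c₁ c₂ K i *
          ((∑ j, pert t κ τ i j * X j) * ∑ j, pert t κ τ i j * Y j) := by
  have h0 := sum_weight (κ := κ) (τ := τ) c₁ c₂ hK
  have h1 : ∀ Z : Fin (t + 1) → ℝ, τ ^ 2 * ∑ i ∈ K, weight t κ τ c₁ c₂ K i *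
      ∑ j, pert t κ τ i j * Z j = c₂ * Z 0 := by
    intro Z
    have : ∑ i ∈ K, weight t κ τ c₁ c₂ K i * ∑ j, pert t κ τ i j * Z j
        = ∑ j, (∑ i ∈ K, weight t κ τ c₁ c₂ K i * pert t κ τ i j) * Z j := by
      simp_rw [Finset.mul_sum, Finset.sum_mul]
      rw [Finset.sum_comm]
      simp_rw [mul_assoc]
    rw [this, Finset.mul_sum]
    simp_rw [← mul_assoc, sum_weight_mul_pert hτ c₁ c₂ hK]
    simp
  have hX := h1 X
  have hY := h1 Y
  unfold estimate
  simp_rw [noiseMap_eq]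
  have : ∀ i, weight t κ τ c₁ c₂ K i * ((a + (X 0 + τ ^ 2 * ∑ j, pert t κ τ i j * X j)) *
      (b + (Y 0 + τ ^ 2 * ∑ j, pert t κ τ i j * Y j))) =
      (a + X 0) * (b + Y 0) * weight t κ τ c₁ c₂ K i +
      (a + X 0) * τ ^ 2 * (weight t κ τ c₁ c₂ K i * ∑ j, pert t κ τ i j * Y j) +
      (b + Y 0) * τ ^ 2 * (weight t κ τ c₁ c₂ K i * ∑ j, pert t κ τ i j * X j) +
      τ * (τ ^ 3 * weight t κ τ c₁ c₂ K i *
          ((∑ j, pert t κ τ i j * X j) * ∑ j, pert t κ τ i j * Y j)) := fun i => by ring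
  simp_rw [this]
  rw [Finset.sum_add_distrib, Finset.sum_add_distrib, Finset.sum_add_distrib, ← Finset.mul_sum,
    ← Finset.mul_sum, ← Finset.mul_sum, ← Finset.mul_sum, h0]
  linear_combination (a + X 0) * hY + (b + Y 0) * hX

variable (N t κ) in
/-- The higher-order part of all estimates is small, uniformly in the selected nodes. -/
theorem exists_estimate_bound (c₁ c₂ : ℝ) :
    ∃ C : ℝ, 0 ≤ C ∧ ∀ τ : ℝ, 0 < τ → τ ≤ 1 → ∀ K : Finset (Fin N), K.card = t + 2 →
      ∀ (a b : ℝ) (X Y : Fin (t + 1) → ℝ),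
        |estimate (weight t κ τ c₁ c₂) K
            (fun i => (a + noiseMap t κ τ X i) * (b + noiseMap t κ τ Y i)) -
          (c₁ * (a * b) + (c₁ + c₂) * (a * Y 0 + b * X 0) + (c₁ + 2 * c₂) * (X 0 * Y 0))|
          ≤ τ * (C * ((∑ j, |X j|) * ∑ j, |Y j|)) := by
  obtain ⟨C, hC⟩ := (Set.finite_range fun z : Fin N × Fin (t + 1) =>
    |(z.1 : ℝ) ^ (t + 1) + κ| + |(z.1 : ℝ) ^ (z.2 : ℕ)|).bddAbove
  obtain ⟨W, hW⟩ := (Set.finite_range fun z : Finset (Fin N) × Fin N =>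
    |c₁ * (Lagrange.basis z.1 (fun i : Fin N => (i : ℝ)) z.2).coeff 0| + (|c₂| + |κ * c₁|) *
      |(Lagrange.basis z.1 (fun i : Fin N => (i : ℝ)) z.2).coeff (t + 1)|).bddAbove
  have hpert : ∀ τ : ℝ, 0 < τ → τ ≤ 1 → ∀ (i : Fin N) (j : Fin (t + 1)), |pert t κ τ i j| ≤ C := by
    intro τ h0 h1 i j
    refine le_trans ?_ (hC (Set.mem_range_self (i, j)))
    unfold pert
    split_ifs
    · rw [abs_mul, abs_of_pos h0]
      have := abs_nonneg ((i : ℝ) ^ (j : ℕ))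
      have := abs_nonneg ((i : ℝ) ^ (t + 1) + κ)
      simp only
      nlinarith
    · simp
  have hweight : ∀ τ : ℝ, 0 < τ → τ ≤ 1 → ∀ (K : Finset (Fin N)) (i : Fin N),
      |τ ^ 3 * weight t κ τ c₁ c₂ K i| ≤ W := by
    intro τ h0 h1 K i
    refine le_trans ?_ (hW (Set.mem_range_self (K, i)))
    set l₀ := (Lagrange.basis K (fun i : Fin N => (i : ℝ)) i).coeff 0 with hl₀
    set l₁ := (Lagrange.basis K (fun i : Fin N => (i : ℝ)) i).coeff (t + 1) with hl₁
    have e : τ ^ 3 * weight t κ τ c₁ c₂ K i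
        = τ ^ 3 * (c₁ * l₀) + (c₂ - τ ^ 3 * (κ * c₁)) * l₁ := by
      rw [weight, ← hl₀, ← hl₁]; field_simp
    have h3 : τ ^ 3 ≤ 1 := pow_le_one₀ h0.le h1
    have h3' : |τ ^ 3| ≤ 1 := by rwa [abs_of_pos (by positivity)]
    rw [e]
    refine (abs_add_le _ _).trans ?_
    rw [abs_mul, abs_mul (c₂ - _)]
    gcongr
    · exact mul_le_of_le_one_left (abs_nonneg _) h3'
    · refine (abs_sub _ _).trans ?_
      rw [abs_mul (τ ^ 3)]
      gcongr
      exact mul_le_of_le_one_left (abs_nonneg _) h3'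
  -- For N = 0 the bounds `W` and `C` are bounds of empty sets and may be negative; the absolute
  -- value and the square keep the constant nonnegative.
  refine ⟨N * (|W| * (C * C)), mul_nonneg (by positivity) (mul_nonneg (abs_nonneg _)
    (mul_self_nonneg C)), ?_⟩
  intro τ h0 h1 K hK a b X Y
  rw [estimate_eq h0.ne' c₁ c₂ hK, add_sub_cancel_left, abs_mul, abs_of_pos h0]
  gcongr
  have hsum : ∀ (i : Fin N) (Z : Fin (t + 1) → ℝ),
      |∑ j, pert t κ τ i j * Z j| ≤ C * ∑ j, |Z j| := by
    intro i Z
    rw [Finset.mul_sum]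
    refine (Finset.abs_sum_le_sum_abs _ _).trans (Finset.sum_le_sum fun j _ => ?_)
    rw [abs_mul]
    gcongr
    exact hpert τ h0 h1 i j
  have hterm : ∀ i ∈ K, |τ ^ 3 * weight t κ τ c₁ c₂ K i *
      ((∑ j, pert t κ τ i j * X j) * ∑ j, pert t κ τ i j * Y j)| ≤
      |W| * ((C * ∑ j, |X j|) * (C * ∑ j, |Y j|)) := by
    intro i _
    rw [abs_mul, abs_mul (∑ j, _)]
    have hX0 := (abs_nonneg _).trans (hsum i X)
    exact mul_le_mul ((hweight τ h0 h1 K i).trans (le_abs_self W))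
      (mul_le_mul (hsum i X) (hsum i Y) (abs_nonneg _) hX0) (by positivity) (abs_nonneg _)
  have hX0 : 0 ≤ (C * ∑ j, |X j|) * (C * ∑ j, |Y j|) := by
    have : (C * ∑ j, |X j|) * (C * ∑ j, |Y j|) = (C * C) * ((∑ j, |X j|) * ∑ j, |Y j|) := by ring
    rw [this]
    exact mul_nonneg (mul_self_nonneg C) (by positivity)
  calc _ ≤ ∑ i ∈ K, |W| * ((C * ∑ j, |X j|) * (C * ∑ j, |Y j|)) :=
        (Finset.abs_sum_le_sum_abs _ _).trans (Finset.sum_le_sum hterm)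
    _ = K.card * (|W| * ((C * ∑ j, |X j|) * (C * ∑ j, |Y j|))) := by
        rw [Finset.sum_const, nsmul_eq_mul]
    _ ≤ N * (|W| * ((C * ∑ j, |X j|) * (C * ∑ j, |Y j|))) := by
        have : (K.card : ℝ) ≤ N := by exact_mod_cast (card_finset_fin_le K)
        gcongr
    _ = _ := by ring

/-- Any `t + 1` nodes see their input through an invertible transform, as a shift of the noise
variables that barely moves any but the first one. -/
theorem exists_shift {𝒯 : Finset (Fin N)} (h𝒯 : 𝒯.card = t + 1) (hτ : 0 ≤ τ)
    (hκ : |interpCoeff t 𝒯 0| ≤ κ) :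
    ∃ u : Fin (t + 1) → ℝ, (∀ i ∈ 𝒯, noiseMap t κ τ u i = 1) ∧ |u 0| ≤ 1 ∧
      ∀ j, j ≠ 0 → |u j| ≤ τ * |interpCoeff t 𝒯 j| := by
  -- On `𝒯` the monomial i^(t+1) agrees with a polynomial of degree at most t. The shifts of X₁, …,
  -- X_t cancel its nonconstant part, leaving the constant `h` by which everything is divided. The
  -- offset κ ensures h ≥ 1, so the shift of X₀ does not exceed 1.
  set h : ℝ := 1 + τ ^ 3 * (κ + interpCoeff t 𝒯 0) with hh
  have h1 : 1 ≤ h := by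
    have : 0 ≤ κ + interpCoeff t 𝒯 0 := by linarith [neg_abs_le (interpCoeff t 𝒯 0)]
    have : 0 ≤ τ ^ 3 * (κ + interpCoeff t 𝒯 0) := by positivity
    linarith
  have h0 : 0 < h := by linarith
  refine ⟨fun j => (if j = 0 then 1 else -(τ * interpCoeff t 𝒯 j)) / h, fun i hi => ?_, ?_, ?_⟩
  · have hs := sum_interpCoeff t h𝒯 hi
    simp only [noiseMap, noiseCoeff, pert]
    rw [Fin.sum_univ_succ] at hs ⊢
    simp only [Fin.succ_ne_zero, if_false, if_true, Fin.val_zero, pow_zero, mul_one, zero_add]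
      at hs ⊢
    have : ∀ j : Fin t, τ ^ 2 * (i : ℝ) ^ (j.succ : ℕ) * (-(τ * interpCoeff t 𝒯 j.succ) / h)
      = -(τ ^ 3 / h) * (interpCoeff t 𝒯 j.succ * (i : ℝ) ^ (j.succ : ℕ)) := fun j => by
        field_simp
    simp_rw [this]
    rw [← Finset.mul_sum, eq_sub_iff_add_eq'.2 hs]
    field_simp
    rw [hh]
    ring
  · simp only [if_true]
    rw [abs_of_pos (by positivity), div_le_one h0]
    exact h1
  · intro j hj
    simp only [hj, if_false]
    rw [abs_div, abs_neg, abs_mul, abs_of_nonneg hτ, abs_of_pos h0]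
    exact div_le_self (by positivity) h1

theorem noiseMap_add_smul (X u : Fin (t + 1) → ℝ) (a : ℝ) (i : Fin N) :
    noiseMap t κ τ (a • u + X) i = a * noiseMap t κ τ u i + noiseMap t κ τ X i := by
  simp only [noiseMap, Pi.add_apply, Pi.smul_apply, smul_eq_mul, mul_add, Finset.sum_add_distrib,
    Finset.mul_sum]
  congr 1
  exact Finset.sum_congr rfl fun j _ => by ring

end Code

/-! ### The error of the limiting linear estimator -/

theorem lintegral_affine_sq {ν : Measure ℝ} [IsProbabilityMeasure ν]
    (h2 : MemLp (fun x : ℝ => x) 2 ν) (h0 : ∫ x, x ∂ν = 0) (c d : ℝ) :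
    ∫⁻ x, ENNReal.ofReal ((c + d * x) ^ 2) ∂ν
      = ENNReal.ofReal (c ^ 2 + d ^ 2 * ∫ x, x ^ 2 ∂ν) := by
  have hi1 : Integrable (fun x : ℝ => x) ν := h2.integrable (by norm_num)
  have hi2 : Integrable (fun x : ℝ => x ^ 2) ν := h2.integrable_sq
  have e : (fun x : ℝ => (c + d * x) ^ 2) = fun x => (c ^ 2 + 2 * c * d * x) + d ^ 2 * x ^ 2 := by
    ext x; ring
  rw [← ofReal_integral_eq_lintegral_ofReal _ (ae_of_all _ fun _ => sq_nonneg _), e]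
  · rw [integral_add _ (hi2.const_mul _), integral_add (integrable_const _) (hi1.const_mul _),
      integral_const_mul, integral_const_mul, h0]
    · simp
    · exact (integrable_const _).add (hi1.const_mul _)
  · rw [e]
    exact ((integrable_const _).add (hi1.const_mul _)).add (hi2.const_mul _)

/-- The optimal linear estimate of a product from noisy observations. -/
theorem lintegral_linear_estimate_le {α β ν : Measure ℝ} [IsProbabilityMeasure ν]
    {η v : ℝ} (hη : 0 ≤ η) (hv : 0 < v) (hα : InputLaw η α) (hβ : InputLaw η β)
    (h2 : MemLp (fun x : ℝ => x) 2 ν) (h0 : ∫ x, x ∂ν = 0) (hvar : ∫ x, x ^ 2 ∂ν ≤ v) :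
    ∫⁻ ω : (ℝ × ℝ) × ℝ × ℝ, ENNReal.ofReal
      ((η * (η + 2 * v) / (η + v) ^ 2 * (ω.1.1 * ω.1.2) +
        η * v / (η + v) ^ 2 * (ω.1.1 * ω.2.2 + ω.1.2 * ω.2.1) +
        -(η ^ 2 / (η + v) ^ 2) * (ω.2.1 * ω.2.2) - ω.1.1 * ω.1.2) ^ 2)
      ∂((α.prod β).prod (ν.prod ν)) ≤ ENNReal.ofReal (η ^ 2 / (1 + η / v) ^ 2) := by
  have := hα.1
  have := hβ.1
  -- With these coefficients the error is -(vA - ηX₀)(vB - ηY₀)/(η + v)², minus the product of the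
  -- errors of A ↦ η(A + X₀)/(η + v) and its analogue for B.
  set c := η * (η + 2 * v) / (η + v) ^ 2 with hc
  set q := η * v / (η + v) ^ 2 with hq
  set Q := -(η ^ 2 / (η + v) ^ 2) with hQ
  have hs := add_pos_of_nonneg_of_pos hη hv
  have hv0 : 0 ≤ ∫ x, x ^ 2 ∂ν := integral_nonneg fun x => sq_nonneg x
  have hinner : ∀ a b : ℝ, ∫⁻ z : ℝ × ℝ, ENNReal.ofReal
      ((c * (a * b) + q * (a * z.2 + b * z.1) + Q * (z.1 * z.2) - a * b) ^ 2) ∂(ν.prod ν)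
      ≤ ENNReal.ofReal ((c - 1) ^ 2) * (ENNReal.ofReal (a ^ 2) * ENNReal.ofReal (b ^ 2)) +
        ENNReal.ofReal (q ^ 2 * v) * ENNReal.ofReal (a ^ 2) +
        ENNReal.ofReal (q ^ 2 * v) * ENNReal.ofReal (b ^ 2) + ENNReal.ofReal (Q ^ 2 * v ^ 2) := by
    intro a b
    rw [lintegral_prod _ (by fun_prop)]
    have e : ∀ x y : ℝ, c * (a * b) + q * (a * y + b * x) + Q * (x * y) - a * b
        = ((c - 1) * (a * b) + q * b * x) + (q * a + Q * x) * y := fun x y => by ring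
    simp_rw [e, lintegral_affine_sq h2 h0]
    have e2 : ∀ x : ℝ, ENNReal.ofReal (((c - 1) * (a * b) + q * b * x) ^ 2 +
        (q * a + Q * x) ^ 2 * ∫ x, x ^ 2 ∂ν) ≤
        ENNReal.ofReal (((c - 1) * (a * b) + q * b * x) ^ 2) +
          ENNReal.ofReal v * ENNReal.ofReal ((q * a + Q * x) ^ 2) := by
      intro x
      rw [← ENNReal.ofReal_mul hv.le, ← ENNReal.ofReal_add (sq_nonneg _) (by positivity)]
      apply ENNReal.ofReal_le_ofReal
      nlinarith [sq_nonneg (q * a + Q * x)]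
    refine (lintegral_mono e2).trans ?_
    rw [lintegral_add_left (by fun_prop), lintegral_const_mul _ (by fun_prop),
      lintegral_affine_sq h2 h0, lintegral_affine_sq h2 h0, ← ENNReal.ofReal_mul hv.le,
      ← ENNReal.ofReal_mul (sq_nonneg _), ← ENNReal.ofReal_mul (sq_nonneg _),
      ← ENNReal.ofReal_mul (by positivity), ← ENNReal.ofReal_mul (by positivity),
      ← ENNReal.ofReal_add (by positivity) (by positivity),
      ← ENNReal.ofReal_add (by positivity) (by positivity),
      ← ENNReal.ofReal_add (by positivity) (by positivity),
      ← ENNReal.ofReal_add (by positivity) (by positivity)]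
    apply ENNReal.ofReal_le_ofReal
    have h1 : (q * b) ^ 2 * ∫ x, x ^ 2 ∂ν ≤ (q * b) ^ 2 * v := by gcongr
    have h2 : v * (Q ^ 2 * ∫ x, x ^ 2 ∂ν) ≤ v * (Q ^ 2 * v) := by gcongr
    nlinarith
  rw [lintegral_prod _ (by fun_prop)]
  refine (lintegral_mono fun p : ℝ × ℝ => hinner p.1 p.2).trans ?_
  have hA := hα.2
  have hB := hβ.2
  have hprod : ∫⁻ p : ℝ × ℝ, ENNReal.ofReal (p.1 ^ 2) * ENNReal.ofReal (p.2 ^ 2) ∂(α.prod β)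
      = (∫⁻ a, ENNReal.ofReal (a ^ 2) ∂α) * ∫⁻ b, ENNReal.ofReal (b ^ 2) ∂β :=
    lintegral_prod_mul (f := fun a : ℝ => ENNReal.ofReal (a ^ 2))
      (g := fun b : ℝ => ENNReal.ofReal (b ^ 2)) (by fun_prop) (by fun_prop)
  have hfst : ∫⁻ p : ℝ × ℝ, ENNReal.ofReal (p.1 ^ 2) ∂(α.prod β)
      = ∫⁻ a, ENNReal.ofReal (a ^ 2) ∂α :=
    measurePreserving_fst.lintegral_comp (f := fun a : ℝ => ENNReal.ofReal (a ^ 2)) (by fun_prop)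
  have hsnd : ∫⁻ p : ℝ × ℝ, ENNReal.ofReal (p.2 ^ 2) ∂(α.prod β)
      = ∫⁻ b, ENNReal.ofReal (b ^ 2) ∂β :=
    measurePreserving_snd.lintegral_comp (f := fun a : ℝ => ENNReal.ofReal (a ^ 2)) (by fun_prop)
  rw [lintegral_add_left (by fun_prop), lintegral_add_left (by fun_prop),
    lintegral_add_left (by fun_prop), lintegral_const_mul _ (by fun_prop),
    lintegral_const_mul _ (by fun_prop), lintegral_const_mul _ (by fun_prop), hprod, hfst, hsnd,
    lintegral_const, measure_univ, mul_one]
  calc _ ≤ ENNReal.ofReal ((c - 1) ^ 2) * (ENNReal.ofReal η * ENNReal.ofReal η) +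
        ENNReal.ofReal (q ^ 2 * v) * ENNReal.ofReal η +
        ENNReal.ofReal (q ^ 2 * v) * ENNReal.ofReal η + ENNReal.ofReal (Q ^ 2 * v ^ 2) := by
        gcongr
    _ = ENNReal.ofReal ((c - 1) ^ 2 * (η * η) + q ^ 2 * v * η + q ^ 2 * v * η + Q ^ 2 * v ^ 2) := by
        rw [ENNReal.ofReal_add (by positivity) (by positivity),
          ENNReal.ofReal_add (by positivity) (by positivity),
          ENNReal.ofReal_add (by positivity) (by positivity),
          ENNReal.ofReal_mul (p := (c - 1) ^ 2) (by positivity), ENNReal.ofReal_mul (p := η) hη,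
          ENNReal.ofReal_mul (p := q ^ 2 * v) (by positivity)]
    _ = ENNReal.ofReal (η ^ 2 / (1 + η / v) ^ 2) := by
        congr 1
        rw [hc, hq, hQ]
        have := hs.ne'
        have h' : v + η ≠ 0 := by rw [add_comm]; exact this
        field_simp
        ring

/-! ### Moments and privacy of the noise vector -/

section Noise

variable {N t : ℕ} {κ τ : ℝ} {μ : Fin (t + 1) → Measure ℝ} [∀ j, IsProbabilityMeasure (μ j)]

theorem memLp_noiseMap (h2 : ∀ j, MemLp (fun x : ℝ => x) 2 (μ j)) (i : Fin N) :
    MemLp (fun X => noiseMap t κ τ X i) 2 (Measure.pi μ) := by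
  unfold noiseMap
  exact memLp_finsetSum _ fun j _ =>
    ((h2 j).comp_measurePreserving (measurePreserving_eval μ j)).const_mul _

theorem integral_noiseMap (h2 : ∀ j, MemLp (fun x : ℝ => x) 2 (μ j))
    (h0 : ∀ j, ∫ x, x ∂(μ j) = 0) (i : Fin N) :
    ∫ X, noiseMap t κ τ X i ∂(Measure.pi μ) = 0 := by
  have hint : ∀ j, Integrable (fun X : Fin (t + 1) → ℝ => X j) (Measure.pi μ) := fun j =>
    ((h2 j).comp_measurePreserving (measurePreserving_eval μ j)).integrable (by norm_num)
  have hj : ∀ j, ∫ X : Fin (t + 1) → ℝ, X j ∂(Measure.pi μ) = 0 := by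
    intro j
    rw [← h0 j, ← (measurePreserving_eval μ j).map_eq,
      integral_map (measurable_pi_apply j).aemeasurable (by fun_prop)]
  unfold noiseMap
  rw [integral_finsetSum _ fun j _ => (hint j).const_mul _]
  simp [integral_const_mul, hj]

theorem lintegral_sum_abs_sq_ne_top (h2 : ∀ j, MemLp (fun x : ℝ => x) 2 (μ j)) :
    ∫⁻ X, ENNReal.ofReal ((∑ j, |X j|) ^ 2) ∂(Measure.pi μ) ≠ ⊤ := by
  have : MemLp (fun X : Fin (t + 1) → ℝ => ∑ j, |X j|) 2 (Measure.pi μ) :=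
    memLp_finsetSum _ fun j _ =>
      ((h2 j).comp_measurePreserving (measurePreserving_eval μ j)).abs
  exact this.integrable_sq.lintegral_lt_top.ne

/-- The stored data of any `t + 1` nodes are private. -/
theorem noiseMap_private {ε ε' : ℝ} (hτ : 0 ≤ τ)
    (hκ : ∀ 𝒯 : Finset (Fin N), ∑ j : Fin (t + 1), |interpCoeff t 𝒯 j| ≤ κ)
    (hτε : ε' + τ * κ ≤ ε) (hfirst : ∀ u : ℝ, |u| ≤ 1 → ShiftBound (μ 0) u ε')
    (hrest : ∀ j, j ≠ 0 → ∀ u : ℝ, ShiftBound (μ j) u |u|) {a a' : ℝ} (ha : |a - a'| ≤ 1)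
    {𝒯 : Finset (Fin N)} (h𝒯 : 𝒯.card = t + 1) {B : Set (𝒯 → ℝ)} (hB : MeasurableSet B) :
    (Measure.pi μ).map (noiseMap t κ τ) {r : Fin N → ℝ | (fun i : 𝒯 => a + r i) ∈ B} ≤
      ENNReal.ofReal (Real.exp ε) *
        (Measure.pi μ).map (noiseMap t κ τ) {r : Fin N → ℝ | (fun i : 𝒯 => a' + r i) ∈ B} := by
  have hm : ∀ (a : ℝ), MeasurableSet {r : Fin N → ℝ | (fun t : 𝒯 => a + r t) ∈ B} := fun a =>
    (measurable_pi_lambda _ fun t : 𝒯 => by fun_prop :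
      Measurable fun (r : Fin N → ℝ) (t : 𝒯) => a + r t) hB
  have h0κ : |interpCoeff t 𝒯 0| ≤ κ :=
    (Finset.single_le_sum (f := fun j : Fin (t + 1) => |interpCoeff t 𝒯 j|)
      (fun _ _ => abs_nonneg _) (Finset.mem_univ 0)).trans (hκ 𝒯)
  obtain ⟨u, hu1, hu0, huj⟩ := exists_shift h𝒯 hτ h0κ
  -- The spare term at j = 0 only makes the costs uniform: they sum to ε' + τ ∑ |interpCoeff|, at
  -- most ε' + τκ.
  have hcoord : ∀ j, ShiftBound (μ j) (((a - a') • u) j)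
      ((if j = 0 then ε' else 0) + τ * |interpCoeff t 𝒯 j|) := by
    intro j
    have hle : |((a - a') • u) j| ≤ |u j| := by
      rw [Pi.smul_apply, smul_eq_mul, abs_mul]
      exact mul_le_of_le_one_left (abs_nonneg _) ha
    by_cases hj : j = 0
    · subst hj
      refine (hfirst _ (hle.trans hu0)).mono ?_
      simp only [if_true, le_add_iff_nonneg_right]
      positivity
    · refine (hrest j hj _).mono ?_
      rw [if_neg hj, zero_add]
      exact hle.trans (huj j hj)
  have hpi := (ShiftBound.pi hcoord).mono (d := ε) (by
    rw [Finset.sum_add_distrib, ← Finset.mul_sum]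
    simp only [Finset.sum_ite_eq', Finset.mem_univ, if_true]
    nlinarith [hκ 𝒯])
  rw [Measure.map_apply (measurable_noiseMap t κ τ) (hm a),
    Measure.map_apply (measurable_noiseMap t κ τ) (hm a')]
  convert hpi _ (measurable_noiseMap t κ τ (hm a')) using 2
  ext X
  simp only [Set.mem_preimage, Set.mem_ofPred_eq, noiseMap_add_smul]
  have : (fun i : 𝒯 => a + noiseMap t κ τ X (i : Fin N))
      = fun i : 𝒯 => a' + ((a - a') * noiseMap t κ τ u (i : Fin N) + noiseMap t κ τ X (i : Fin N)) := by
    ext i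
    rw [hu1 i i.2]
    ring
  rw [this]

end Noise

/-! ### Positivity of the optimal variance -/

/-- By Chebyshev, a small variance puts most mass within 1/4 of the mean. A shift by 1/2 moves that
interval into the tail, so privacy would make its mass small too. -/
theorem le_variance_of_noiseDP {ε : ℝ} {μ : Measure ℝ} [IsProbabilityMeasure μ]
    (h : NoiseDP ε μ) (h2 : MemLp (fun x : ℝ => x) 2 μ) :
    1 / (16 * (1 + Real.exp ε)) ≤ Var[fun x : ℝ => x; μ] := by
  set V := Var[fun x : ℝ => x; μ] with hV
  have hV0 : 0 ≤ V := variance_nonneg _ _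
  set m := ∫ x, x ∂μ with hm
  have hcheb : μ {x | 1 / 4 ≤ |x - m|} ≤ ENNReal.ofReal (16 * V) := by
    refine (meas_ge_le_variance_div_sq h2 (by norm_num : (0 : ℝ) < 1 / 4)).trans_eq ?_
    congr 1
    ring
  have hI : MeasurableSet {x : ℝ | |x - m| < 1 / 4} :=
    measurableSet_lt (by fun_prop) measurable_const
  have hshift : μ {x | |x - m| < 1 / 4} ≤
      ENNReal.ofReal (Real.exp ε) * ENNReal.ofReal (16 * V) := by
    have := h 0 (1 / 2) (by norm_num [abs_le]) _ hI
    simp only [Set.mem_ofPred_eq, zero_add] at this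
    refine this.trans ?_
    gcongr
    refine (measure_mono fun x hx => ?_).trans hcheb
    simp only [Set.mem_ofPred_eq] at hx ⊢
    rw [abs_lt] at hx
    rw [le_abs]
    right
    linarith
  have hle : (1 : ℝ≥0∞) ≤ ENNReal.ofReal ((1 + Real.exp ε) * (16 * V)) := by
    calc (1 : ℝ≥0∞) = μ ({x | 1 / 4 ≤ |x - m|} ∪ {x | |x - m| < 1 / 4}) := by
          rw [← measure_univ (μ := μ)]
          congr 1
          ext x
          simp [le_or_gt]
      _ ≤ μ {x | 1 / 4 ≤ |x - m|} + μ {x | |x - m| < 1 / 4} := measure_union_le _ _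
      _ ≤ ENNReal.ofReal (16 * V) + ENNReal.ofReal (Real.exp ε) * ENNReal.ofReal (16 * V) := by
          gcongr
      _ = _ := by
          rw [← ENNReal.ofReal_mul (Real.exp_pos _).le, ← ENNReal.ofReal_add (by positivity)
            (by positivity)]
          congr 1
          ring
  rw [ENNReal.one_le_ofReal] at hle
  rw [div_le_iff₀ (by positivity)]
  linarith

theorem optNoiseVar_pos {ε : ℝ} (hε : 0 < ε) : 0 < optNoiseVar ε := by
  obtain ⟨μ, h1, h2, h3, -⟩ := exists_noiseDP_variance_lt hε one_pos
  refine lt_of_lt_of_le (by positivity : 0 < 1 / (16 * (1 + Real.exp ε)))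
    (le_csInf ⟨_, μ, h1, h2, h3, rfl⟩ ?_)
  rintro v ⟨μ, _, h2, h3, rfl⟩
  exact le_variance_of_noiseDP h2 h3

/-! ### The mean square error of the code -/

section Error

variable {N t : ℕ} {μ : Fin (t + 1) → Measure ℝ} [∀ j, IsProbabilityMeasure (μ j)]

/-- The mean square error of the code exceeds that of the optimal linear estimate by a multiple of
the parameter `τ`, uniformly in the laws of the inputs. -/
theorem exists_code_error_bound (κ : ℝ) {η v : ℝ} (hη : 0 ≤ η) (hv : 0 < v)
    (h2 : ∀ j, MemLp (fun x : ℝ => x) 2 (μ j)) (h0 : ∫ x, x ∂(μ 0) = 0)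
    (hvar : ∫ x, x ^ 2 ∂(μ 0) ≤ v) {K₀ : Finset (Fin N)} (hK₀ : K₀.card = t + 2) :
    ∃ c₁ c₂ C : ℝ, 0 ≤ C ∧ ∀ τ : ℝ, 0 < τ → τ ≤ 1 → ∀ α β : Measure ℝ,
      InputLaw η α → InputLaw η β →
      ∫⁻ ω, ENNReal.ofReal
        ((|estimate (weight t κ τ c₁ c₂) K₀
            (fun i : Fin N => (ω.1.1 + ω.2.1 i) * (ω.1.2 + ω.2.2 i)) - ω.1.1 * ω.1.2| +
          2 * spread (weight t κ τ c₁ c₂) (t + 2) Finset.univ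
            (fun i : Fin N => (ω.1.1 + ω.2.1 i) * (ω.1.2 + ω.2.2 i))) ^ 2)
        ∂((α.prod β).prod (((Measure.pi μ).map (noiseMap t κ τ)).prod
          ((Measure.pi μ).map (noiseMap t κ τ)))) ≤
      ENNReal.ofReal ((1 + τ) * (η ^ 2 / (1 + η / v) ^ 2) + τ * C) := by
  set c₁ := η * (η + 2 * v) / (η + v) ^ 2 with hc₁
  set q := η * v / (η + v) ^ 2 with hq
  have hs : η + v ≠ 0 := (add_pos_of_nonneg_of_pos hη hv).ne'
  -- The code only reaches coefficient triples (c, q, 2q - c); the optimal triple happens to have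
  -- this form.
  have hQ : c₁ + 2 * (q - c₁) = -(η ^ 2 / (η + v) ^ 2) := by
    rw [hc₁, hq]; field_simp; ring
  obtain ⟨D, hD0, hD⟩ := exists_estimate_bound N t κ c₁ (q - c₁)
  set M : ℝ := (((Finset.univ : Finset (Fin N)).powersetCard (t + 2)).card : ℝ) with hM
  -- The estimate from `K₀` costs D; twice the spread costs 2 · M² · 2D, from M² pairs of subsets
  -- whose estimates differ by at most 2D, all in units of τS.
  set C := D + 4 * M ^ 2 * D with hC
  set L := ∫⁻ X, ENNReal.ofReal ((∑ j, |X j|) ^ 2) ∂(Measure.pi μ) with hL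
  have hLtop : L ≠ ⊤ := lintegral_sum_abs_sq_ne_top h2
  refine ⟨c₁, q - c₁, 2 * C ^ 2 * L.toReal ^ 2, by positivity, ?_⟩
  intro τ hτ hτ1 α β hα hβ
  have := hα.1
  have := hβ.1
  have hΦ : MeasurePreserving (noiseMap t κ τ : _ → Fin N → ℝ) (Measure.pi μ)
      ((Measure.pi μ).map (noiseMap t κ τ)) := ⟨measurable_noiseMap t κ τ, rfl⟩
  have hPprob : IsProbabilityMeasure ((Measure.pi μ).map (noiseMap t κ τ : _ → Fin N → ℝ)) :=
    Measure.isProbabilityMeasure_map (measurable_noiseMap t κ τ).aemeasurable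
  have hmap := (MeasurePreserving.id (α.prod β)).prod (hΦ.prod hΦ)
  rw [← hmap.map_eq]
  refine (lintegral_map_le _ _).trans ?_
  set err : (ℝ × ℝ) × ℝ × ℝ → ℝ := fun ω => c₁ * (ω.1.1 * ω.1.2) +
        q * (ω.1.1 * ω.2.2 + ω.1.2 * ω.2.1) +
        -(η ^ 2 / (η + v) ^ 2) * (ω.2.1 * ω.2.2) - ω.1.1 * ω.1.2 with herr
  have herrm : Measurable err := by rw [herr]; fun_prop
  have hpt : ∀ ω : (ℝ × ℝ) × (Fin (t + 1) → ℝ) × (Fin (t + 1) → ℝ),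
      ENNReal.ofReal
        ((|estimate (weight t κ τ c₁ (q - c₁)) K₀ (fun i : Fin N => (ω.1.1 + noiseMap t κ τ ω.2.1 i) *
            (ω.1.2 + noiseMap t κ τ ω.2.2 i)) - ω.1.1 * ω.1.2| +
          2 * spread (weight t κ τ c₁ (q - c₁)) (t + 2) Finset.univ
            (fun i : Fin N => (ω.1.1 + noiseMap t κ τ ω.2.1 i) *
              (ω.1.2 + noiseMap t κ τ ω.2.2 i))) ^ 2) ≤
      ENNReal.ofReal (1 + τ) * ENNReal.ofReal (err (ω.1, (ω.2.1 0, ω.2.2 0)) ^ 2) +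
        ENNReal.ofReal (τ * (2 * C ^ 2)) * (ENNReal.ofReal ((∑ j, |ω.2.1 j|) ^ 2) *
          ENNReal.ofReal ((∑ j, |ω.2.2 j|) ^ 2)) := by
    rintro ⟨⟨a, b⟩, X, Y⟩
    simp only
    set e := fun K => estimate (weight t κ τ c₁ (q - c₁)) K
      (fun i : Fin N => (a + noiseMap t κ τ X i) * (b + noiseMap t κ τ Y i)) with he
    set Z := c₁ * (a * b) + (c₁ + (q - c₁)) * (a * Y 0 + b * X 0) +
      (c₁ + 2 * (q - c₁)) * (X 0 * Y 0) with hZ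
    set S := (∑ j, |X j|) * ∑ j, |Y j| with hS
    have hS0 : 0 ≤ S := by positivity
    have hclose : ∀ K : Finset (Fin N), K.card = t + 2 → |e K - Z| ≤ τ * (D * S) :=
      fun K hK => hD τ hτ hτ1 K hK a b X Y
    have herrZ : err ((a, b), (X 0, Y 0)) = Z - a * b := by
      rw [hZ, hQ]; simp only [herr]; ring
    have h1 : |e K₀ - a * b| ≤ |Z - a * b| + τ * (D * S) := by
      have := abs_sub_le (e K₀) Z (a * b)
      linarith [hclose K₀ hK₀]
    have h2 : spread (weight t κ τ c₁ (q - c₁)) (t + 2) Finset.univ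
        (fun i : Fin N => (a + noiseMap t κ τ X i) * (b + noiseMap t κ τ Y i))
        ≤ M ^ 2 * (2 * (τ * (D * S))) := by
      unfold spread
      refine (Finset.sum_le_sum fun K hK => Finset.sum_le_sum (g := fun _ => 2 * (τ * (D * S)))
        fun K' hK' => ?_).trans (le_of_eq ?_)
      · have g1 := hclose K (Finset.mem_powersetCard.1 hK).2
        have g2 := hclose K' (Finset.mem_powersetCard.1 hK').2
        rw [abs_sub_comm] at g2
        have := abs_sub_le (e K) Z (e K')
        exact this.trans (by linarith)
      · simp only [Finset.sum_const, nsmul_eq_mul, ← hM]; ring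
    have h3 : |e K₀ - a * b| + 2 * spread (weight t κ τ c₁ (q - c₁)) (t + 2) Finset.univ
        (fun i : Fin N => (a + noiseMap t κ τ X i) * (b + noiseMap t κ τ Y i))
        ≤ |Z - a * b| + τ * (C * S) := by
      have : τ * (C * S) = τ * (D * S) + 2 * (M ^ 2 * (2 * (τ * (D * S)))) := by rw [hC]; ring
      linarith
    rw [← ENNReal.ofReal_mul (by positivity), ← ENNReal.ofReal_mul (by positivity),
      ← ENNReal.ofReal_mul (by positivity), ← ENNReal.ofReal_add (by positivity) (by positivity)]
    apply ENNReal.ofReal_le_ofReal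
    rw [herrZ]
    have h4 := pow_le_pow_left₀ (add_nonneg (abs_nonneg _)
      (mul_nonneg zero_le_two (spread_nonneg _ _))) h3 2
    refine h4.trans ?_
    have h5 : (∑ j, |X j|) ^ 2 * (∑ j, |Y j|) ^ 2 = S ^ 2 := by rw [hS]; ring
    rw [h5, ← sq_abs (Z - a * b)]
    -- For x = |Z - ab|, y = CS and τ ≤ 1: (x + τy)² ≤ (1 + τ)x² + 2τy², by 2xy ≤ x² + y² and τ² ≤
    -- τ.
    have h6 := mul_nonneg hτ.le (sq_nonneg (|Z - a * b| - C * S))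
    have h7 := mul_nonneg (mul_nonneg hτ.le (sub_nonneg.2 hτ1)) (sq_nonneg (C * S))
    nlinarith
  refine (lintegral_mono hpt).trans ?_
  have hproj : MeasurePreserving
      (Prod.map id (Prod.map (Function.eval 0) (Function.eval 0)) :
        (ℝ × ℝ) × (Fin (t + 1) → ℝ) × (Fin (t + 1) → ℝ) → (ℝ × ℝ) × ℝ × ℝ)
      ((α.prod β).prod ((Measure.pi μ).prod (Measure.pi μ)))
      ((α.prod β).prod ((μ 0).prod (μ 0))) :=
    (MeasurePreserving.id (α.prod β)).prod
      ((measurePreserving_eval μ 0).prod (measurePreserving_eval μ 0))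
  have hmain : ∫⁻ ω : (ℝ × ℝ) × (Fin (t + 1) → ℝ) × (Fin (t + 1) → ℝ),
      ENNReal.ofReal (err (ω.1, (ω.2.1 0, ω.2.2 0)) ^ 2)
      ∂((α.prod β).prod ((Measure.pi μ).prod (Measure.pi μ))) ≤
      ENNReal.ofReal (η ^ 2 / (1 + η / v) ^ 2) := by
    refine le_trans (le_of_eq ?_) (lintegral_linear_estimate_le hη hv hα hβ (h2 0) h0 hvar)
    exact hproj.lintegral_comp (f := fun ω => ENNReal.ofReal (err ω ^ 2)) (by fun_prop)
  have hrest : ∫⁻ ω : (ℝ × ℝ) × (Fin (t + 1) → ℝ) × (Fin (t + 1) → ℝ),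
      (ENNReal.ofReal ((∑ j, |ω.2.1 j|) ^ 2) * ENNReal.ofReal ((∑ j, |ω.2.2 j|) ^ 2))
      ∂((α.prod β).prod ((Measure.pi μ).prod (Measure.pi μ))) = L * L := by
    have hf : Measurable fun X : Fin (t + 1) → ℝ => ENNReal.ofReal ((∑ j, |X j|) ^ 2) := by
      fun_prop
    rw [hL, ← lintegral_prod_mul hf.aemeasurable hf.aemeasurable]
    exact measurePreserving_snd.lintegral_comp
      (f := fun z : (Fin (t + 1) → ℝ) × (Fin (t + 1) → ℝ) =>
        ENNReal.ofReal ((∑ j, |z.1 j|) ^ 2) * ENNReal.ofReal ((∑ j, |z.2 j|) ^ 2)) (by fun_prop)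
  rw [lintegral_add_left (by fun_prop), lintegral_const_mul _ (by fun_prop),
    lintegral_const_mul _ (by fun_prop), hrest]
  refine (add_le_add_left (mul_le_mul_right hmain _) _).trans (le_of_eq ?_)
  rw [← ENNReal.ofReal_toReal hLtop, ENNReal.toReal_ofReal ENNReal.toReal_nonneg,
    ← ENNReal.ofReal_mul ENNReal.toReal_nonneg, ← ENNReal.ofReal_mul (by positivity),
    ← ENNReal.ofReal_mul (by positivity), ← ENNReal.ofReal_add (by positivity) (by positivity)]
  congr 1
  ring

end Error

/-! ### Existence of the schemes -/

/-- Without colluding nodes no noise is needed. -/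
theorem exists_scheme_zero {N E A : ℕ} (hN : E + 2 * A + 1 ≤ N) {ε : ℝ} (hε : 0 < ε) :
    ∃ C : Scheme N, C.NodeDP 0 ε ∧ C.SelectsThenLinear 1 ∧
      ∀ α β : Measure ℝ, IsProbabilityMeasure α → IsProbabilityMeasure β → C.mse E A α β = 0 := by
  obtain ⟨K₀, -, hK₀⟩ := Finset.exists_subset_card_eq (s := (Finset.univ : Finset (Fin N)))
    (n := 1) (by rw [Finset.card_fin]; omega)
  refine ⟨codeScheme (Measure.dirac (0 : Fin N → ℝ)) (fun i => integrable_dirac (by simp))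
    (fun i => by simp) (fun _ _ => 1) 1 (1 + A), codeScheme_nodeDP ?_,
    codeScheme_selectsThenLinear, ?_⟩
  · intro a a' _ 𝒯 h𝒯 B _
    have : IsEmpty 𝒯 := by rw [Finset.card_eq_zero.1 h𝒯]; infer_instance
    have : ∀ r : Fin N → ℝ, (fun i : 𝒯 => a + r i) = fun i : 𝒯 => a' + r i :=
      fun r => Subsingleton.elim _ _
    simp_rw [this]
    refine le_mul_of_one_le_left' ?_
    rw [ENNReal.one_le_ofReal]
    exact Real.one_le_exp hε.le
  · intro α β _ _
    refine le_antisymm ((codeScheme_mse_le (by omega) α β hK₀).trans ?_) zero_le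
    rw [Measure.dirac_prod_dirac, Measure.prod_dirac]
    refine (lintegral_map_le _ _).trans ?_
    have he : ∀ (a b : ℝ) (K : Finset (Fin N)), K.card = 1 →
        estimate (fun _ _ => 1) K (fun _ => a * b) = a * b := fun a b K hK => by
      simp [estimate, hK]
    have hspread : ∀ a b : ℝ, spread (fun _ _ => 1) 1 (Finset.univ : Finset (Fin N))
        (fun _ => a * b) = 0 := fun a b =>
      Finset.sum_eq_zero fun K hK => Finset.sum_eq_zero fun K' hK' => by
        rw [he a b K (Finset.mem_powersetCard.1 hK).2, he a b K' (Finset.mem_powersetCard.1 hK').2]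
        simp
    simp [he _ _ K₀ hK₀, hspread]

theorem exists_scheme_succ {N t E A : ℕ} (hN : t + 1 + E + 2 * A + 1 ≤ N) {ε η γ : ℝ}
    (hε : 0 < ε) (hη : 0 ≤ η) (hγ : 0 < γ) :
    ∃ C : Scheme N, C.NodeDP (t + 1) ε ∧ C.SelectsThenLinear (t + 1 + 1) ∧
      ∀ α β : Measure ℝ, InputLaw η α → InputLaw η β →
        C.mse E A α β ≤ ENNReal.ofReal (η ^ 2 / (1 + optSNR η ε) ^ 2 + γ) := by
  have hv₀ := optNoiseVar_pos hε
  -- Half of γ pays for the excess variance ξ of the noise, by continuity at 0 (the optimal variance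
  -- is positive); the other half pays for τ.
  obtain ⟨ξ, hξ, hle⟩ : ∃ ξ : ℝ, 0 < ξ ∧
      η ^ 2 / (1 + η / (optNoiseVar ε + ξ)) ^ 2 < η ^ 2 / (1 + optSNR η ε) ^ 2 + γ / 2 := by
    have hcont : ContinuousAt (fun ξ : ℝ => η ^ 2 / (1 + η / (optNoiseVar ε + ξ)) ^ 2) 0 := by
      refine ContinuousAt.div (by fun_prop) (ContinuousAt.pow (ContinuousAt.add (by fun_prop)
        (ContinuousAt.div (by fun_prop) (by fun_prop) ?_)) 2) ?_
      · simpa using hv₀.ne'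
      · rw [add_zero]; positivity
    have hev := (hcont.eventually_lt (continuousAt_const (y := η ^ 2 / (1 + optSNR η ε) ^ 2 + γ / 2))
      (by rw [add_zero, optSNR]; linarith)).filter_mono
        (nhdsWithin_le_nhds (s := Set.Ioi (0 : ℝ)))
    obtain ⟨ξ, h1, h2⟩ := (hev.and self_mem_nhdsWithin).exists
    exact ⟨ξ, h2, h1⟩
  obtain ⟨ν, ε', hν1, hε', hν2, hν0, hνvar, hνDP⟩ := exists_noise_near_optimal hε hξ
  obtain ⟨ρ, hρ1, hρ2, hρ0, hρDP⟩ := exists_laplace_noise one_pos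
  set v := optNoiseVar ε + ξ with hv
  have hvpos : 0 < v := by positivity
  let μ : Fin (t + 1) → Measure ℝ := Fin.cons ν fun _ => ρ
  have hμ0 : μ 0 = ν := rfl
  have hμs : ∀ j : Fin t, μ j.succ = ρ := fun j => rfl
  have hμ1 : ∀ j, IsProbabilityMeasure (μ j) := Fin.cases hν1 fun _ => hρ1
  have hμ2 : ∀ j, MemLp (fun x : ℝ => x) 2 (μ j) := Fin.cases hν2 fun _ => hρ2
  have hμm : ∀ j, ∫ x, x ∂(μ j) = 0 := Fin.cases hν0 fun _ => hρ0
  obtain ⟨κ, hκ⟩ := (Set.finite_range fun 𝒯 : Finset (Fin N) =>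
    ∑ j : Fin (t + 1), |interpCoeff t 𝒯 j|).bddAbove
  have hκ' : ∀ 𝒯 : Finset (Fin N), ∑ j : Fin (t + 1), |interpCoeff t 𝒯 j| ≤ κ :=
    fun 𝒯 => hκ (Set.mem_range_self 𝒯)
  have hκ0 : 0 ≤ κ := (Finset.sum_nonneg fun _ _ => abs_nonneg _).trans (hκ' ∅)
  obtain ⟨K₀, -, hK₀⟩ := Finset.exists_subset_card_eq (s := (Finset.univ : Finset (Fin N)))
    (n := t + 2) (by rw [Finset.card_fin]; omega)
  obtain ⟨c₁, c₂, C, hC0, hC⟩ := exists_code_error_bound (μ := μ) κ hη hvpos hμ2 hν0 hνvar hK₀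
  set b := η ^ 2 / (1 + η / v) ^ 2 with hb
  have hb0 : 0 ≤ b := by positivity
  -- Neither κ nor `C` depends on τ or on the input laws, so one τ meets both the privacy and the
  -- error budget for all inputs. The added 1's keep the denominators positive.
  obtain ⟨τ, hτ, hτ1, hτκ, hτb⟩ : ∃ τ : ℝ, 0 < τ ∧ τ ≤ 1 ∧ τ * κ ≤ ε - ε' ∧
      τ * (b + C) ≤ γ / 2 := by
    have hd : 0 < ε - ε' := sub_pos.2 hε'
    refine ⟨min 1 (min ((ε - ε') / (κ + 1)) (γ / 2 / (b + C + 1))), by positivity,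
      min_le_left _ _, ?_, ?_⟩
    · have h1 : min 1 (min ((ε - ε') / (κ + 1)) (γ / 2 / (b + C + 1))) ≤ (ε - ε') / (κ + 1) :=
        (min_le_right _ _).trans (min_le_left _ _)
      have h2 := mul_le_mul_of_nonneg_right h1 hκ0
      refine h2.trans ?_
      rw [div_mul_eq_mul_div, div_le_iff₀ (by positivity)]
      nlinarith
    · have h1 : min 1 (min ((ε - ε') / (κ + 1)) (γ / 2 / (b + C + 1))) ≤ γ / 2 / (b + C + 1) :=
        (min_le_right _ _).trans (min_le_right _ _)
      have h2 := mul_le_mul_of_nonneg_right h1 (add_nonneg hb0 hC0)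
      refine h2.trans ?_
      rw [div_mul_eq_mul_div, div_le_iff₀ (by positivity)]
      nlinarith
  have hm := measurable_noiseMap (N := N) t κ τ
  have hP : IsProbabilityMeasure ((Measure.pi μ).map (noiseMap t κ τ : _ → Fin N → ℝ)) :=
    Measure.isProbabilityMeasure_map hm.aemeasurable
  have hint : ∀ i : Fin N, Integrable (fun r => r i) ((Measure.pi μ).map (noiseMap t κ τ)) :=
    fun i => (integrable_map_measure (measurable_pi_apply i).aestronglyMeasurable hm.aemeasurable).2
      ((memLp_noiseMap hμ2 i).integrable (by norm_num))
  have hmean : ∀ i : Fin N, ∫ r, r i ∂((Measure.pi μ).map (noiseMap t κ τ)) = 0 := fun i => by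
    rw [integral_map hm.aemeasurable (measurable_pi_apply i).aestronglyMeasurable]
    exact integral_noiseMap hμ2 hμm i
  refine ⟨codeScheme _ hint hmean (weight t κ τ c₁ c₂) (t + 2) (t + 2 + A),
    codeScheme_nodeDP fun a a' ha 𝒯 h𝒯 B hB => ?_, codeScheme_selectsThenLinear, ?_⟩
  · refine noiseMap_private hτ.le hκ' (by linarith) hνDP (Fin.cases (by simp) fun j _ u => ?_)
      ha h𝒯 hB
    exact (hρDP u).mono (by rw [one_mul])
  · intro α β hα hβ
    refine (codeScheme_mse_le (by omega) α β hK₀).trans ((hC τ hτ hτ1 α β hα hβ).trans ?_)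
    apply ENNReal.ofReal_le_ofReal
    linarith

end SecureMult

theorem theorem2 (N T E A : ℕ) (hN : T + E + 2 * A + 1 ≤ N) (ε η : ℝ) (hε : 0 < ε) (hη : 0 ≤ η)
    (γ : ℝ) (hγ : 0 < γ) :
    ∃ C : SecureMult.Scheme N,
      C.NodeDP T ε ∧ C.SelectsThenLinear (T + 1) ∧
        ∀ α β : MeasureTheory.Measure ℝ, SecureMult.InputLaw η α → SecureMult.InputLaw η β →
          C.mse E A α β ≤ ENNReal.ofReal (η ^ 2 / (1 + SecureMult.optSNR η ε) ^ 2 + γ) := by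
  cases T with
  | zero =>
    obtain ⟨C, h1, h2, h3⟩ := SecureMult.exists_scheme_zero (N := N) (E := E) (A := A)
      (by omega) hε
    refine ⟨C, h1, h2, fun α β hα hβ => ?_⟩
    rw [h3 α β hα.1 hβ.1]
    exact zero_le
  | succ t => exact SecureMult.exists_scheme_succ hN hε hη hγ
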